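/- Work in the language $L_2$ of second order arithmetic, with number variables, set variables, $0,1,+,\cdot,<,=,\in$. $\mathsf{RCA}_0$ is the theory consisting of the basic arithmetical axioms, $\Sigma^0_1$ induction and $\Delta^0_1$ comprehension (with parameters). Let $[n]=\{0,\dots,n\}$; a function $f:\mathbb N\to[n]$ is a set of coded pairs, where $(i,j)=(i+j)^2+i$, and $\bar f y=\bar g y$ means that $f(i)=g(i)$ for all $i<y$. For a formula $A(f,\underline x)$ with a distinguished set variable $f$, a distinguished finite tuple $\underline x$ of number variables, possibly further number and set parameters, and not containing $n$ free, let $\mathrm{cont}(A)$ be $$\forall f:\mathbb N\to[n]\ \forall z\ \exists y\ \forall g:\mathbb N\to[n]\ \big[\bar f y=\bar g y\to\forall \underline x\le z\,\big(A(f,\underline x)\leftrightarrow A(g,\underline x)\big)\big].$$ $\mathsf{CUB}$ is the schema of (the universal closures of) all formulas $$\forall n\,\big[\mathrm{cont}(A)\wedge\forall f:\mathbb N\to[n]\ \exists\underline x\,A(f,\underline x)\ \to\ \exists z\ \forall f:\mathbb N\to[n]\ \exists\underline x\le z\,A(f,\underline x)\big],$$ and $\mathsf{CUB}'$ is the schema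 of all formulas $$\forall n\,\big[\mathrm{cont}(A)\wedge\forall f:\mathbb N\to[n]\ \exists\underline x\,A(f,\underline x)\ \to\ \exists z\ \forall f:\mathbb N\to[n]\ \exists\underline x\le z\,\big(A(f,\underline x)\wedge\forall g:\mathbb N\to[n]\,(\bar f z=\bar g z\to A(g,\underline x))\big)\big].$$ For a class $\Gamma$ of formulas, $\Gamma\text{-}\mathsf{CUB}$ and $\Gamma\text{-}\mathsf{CUB}'$ are the restrictions of these schemata to $A\in\Gamma$. Here $\Sigma^0_0$ is the class of formulas all of whose quantifiers are bounded number quantifiers, and $\Pi^0_1$ the class of formulas $\forall w_1\cdots\forall w_k\,\theta$ with $w_1,\dots,w_k$ number variables and $\theta$ in $\Sigma^0_0$. **Proposition.** $\mathsf{RCA}_0$ proves the following equivalences: 1. $\Sigma^0_0\text{-}\mathsf{CUB}\leftrightarrow\Sigma^0_0\text{-}\mathsf{CUB}'$; 2. $\Pi^0_1\text{-}\mathsf{CUB}\leftrightarrow\Pi^0_1\text{-}\mathsf{CUB}'$; 3. $\mathsf{CUB}\leftrightarrow\mathsf{CUB}'$. That is, in each case every instance of either schema is a logical consequence of $\mathsf{RCA}_0$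 together with all instances of the other schema (it is true in every model of them, the set variables of an $L_2$-structure ranging over an arbitrary nonempty collection of subsets of its first order domain). -/

import Mathlib

/-! Second order arithmetic: the two-sorted language L₂ (numbers and sets of numbers), its
structures, the theory RCA₀, and the schemata CUB and CUB′. -/

universe u

namespace SOA

/-- Numerical terms of L₂ in the number variables `0, …, p - 1`. -/
inductive Term : ℕ → Type
  | var {p : ℕ} (i : Fin p) : Term p
  | zero {p : ℕ} : Term p
  | one {p : ℕ} : Term p
  | add {p : ℕ} (s t : Term p) : Term p
  | mul {p : ℕ} (s t : Term p) : Term p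

/-- Formulas of L₂ whose free number variables are among `0, …, p - 1` and whose free set
variables are among `0, …, q - 1`. A quantifier binds the last variable of its sort. -/
inductive Formula : ℕ → ℕ → Type
  | eq {p q : ℕ} (s t : Term p) : Formula p q
  | lt {p q : ℕ} (s t : Term p) : Formula p q
  | mem {p q : ℕ} (t : Term p) (X : Fin q) : Formula p q
  | neg {p q : ℕ} (φ : Formula p q) : Formula p q
  | and {p q : ℕ} (φ ψ : Formula p q) : Formula p q
  | or {p q : ℕ} (φ ψ : Formula p q) : Formula p q
  | imp {p q : ℕ} (φ ψ : Formula p q) : Formula p q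
  | iff {p q : ℕ} (φ ψ : Formula p q) : Formula p q
  | allN {p q : ℕ} (φ : Formula (p + 1) q) : Formula p q
  | exN {p q : ℕ} (φ : Formula (p + 1) q) : Formula p q
  | allS {p q : ℕ} (φ : Formula p (q + 1)) : Formula p q
  | exS {p q : ℕ} (φ : Formula p (q + 1)) : Formula p q

/-- Sentences of L₂. -/
abbrev Sentence : Type := Formula 0 0

/-! ### Structures and satisfaction -/

/-- An L₂-structure: the set variables range over a nonempty collection `sets` of subsets of the
first order domain (not necessarily over all subsets). -/
structure Structure : Type (u + 1) where
  carrier : Type u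
  zero : carrier
  one : carrier
  add : carrier → carrier → carrier
  mul : carrier → carrier → carrier
  lt : carrier → carrier → Prop
  sets : Set (Set carrier)
  sets_nonempty : sets.Nonempty

/-- The value of a term. -/
def Term.val (M : Structure.{u}) : {p : ℕ} → Term p → (Fin p → M.carrier) → M.carrier
  | _, .var i, e => e i
  | _, .zero, _ => M.zero
  | _, .one, _ => M.one
  | _, .add s t, e => M.add (s.val M e) (t.val M e)
  | _, .mul s t, e => M.mul (s.val M e) (t.val M e)

/-- Satisfaction of a formula, for values `e` of the number variables and `E` of the set
variables. -/
def Formula.Sat (M : Structure.{u}) :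
    {p q : ℕ} → Formula p q → (Fin p → M.carrier) → (Fin q → M.sets) → Prop
  | _, _, .eq s t, e, _ => s.val M e = t.val M e
  | _, _, .lt s t, e, _ => M.lt (s.val M e) (t.val M e)
  | _, _, .mem t X, e, E => t.val M e ∈ (E X : Set M.carrier)
  | _, _, .neg φ, e, E => ¬ φ.Sat M e E
  | _, _, .and φ ψ, e, E => φ.Sat M e E ∧ ψ.Sat M e E
  | _, _, .or φ ψ, e, E => φ.Sat M e E ∨ ψ.Sat M e E
  | _, _, .imp φ ψ, e, E => φ.Sat M e E → ψ.Sat M e E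
  | _, _, .iff φ ψ, e, E => φ.Sat M e E ↔ ψ.Sat M e E
  | p, _, .allN φ, e, E =>
      ∀ a : M.carrier, φ.Sat M (Fin.snoc (α := fun _ : Fin (p + 1) => M.carrier) e a) E
  | p, _, .exN φ, e, E =>
      ∃ a : M.carrier, φ.Sat M (Fin.snoc (α := fun _ : Fin (p + 1) => M.carrier) e a) E
  | _, q, .allS φ, e, E =>
      ∀ X : M.sets, φ.Sat M e (Fin.snoc (α := fun _ : Fin (q + 1) => M.sets) E X)
  | _, q, .exS φ, e, E =>
      ∃ X : M.sets, φ.Sat M e (Fin.snoc (α := fun _ : Fin (q + 1) => M.sets) E X)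

/-- The sentence `φ` is true in `M`. -/
def Structure.Models (M : Structure.{u}) (φ : Sentence) : Prop :=
  φ.Sat M Fin.elim0 Fin.elim0

/-- The sentence `φ` is a logical consequence of the set `T` of sentences: it is true in all
L₂-structures in which the elements of `T` are true. -/
def Entails (T : Set Sentence) (φ : Sentence) : Prop :=
  ∀ M : Structure.{u}, (∀ ψ ∈ T, M.Models ψ) → M.Models φ

/-- Over the theory `T`, the schemata `S` and `S'` are equivalent: `T` together with (all instances
of) either of them has every instance of the other one as a consequence. -/
def EquivOver (T S S' : Set Sentence) : Prop :=
  (∀ φ ∈ S', Entails.{u} (T ∪ S) φ) ∧ (∀ φ ∈ S, Entails.{u} (T ∪ S') φ)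

/-! ### Substitution and abbreviations -/

/-- Substitution of terms for the number variables of a term. -/
def Term.subst : {p p' : ℕ} → Term p → (Fin p → Term p') → Term p'
  | _, _, .var i, τ => τ i
  | _, _, .zero, _ => .zero
  | _, _, .one, _ => .one
  | _, _, .add s t, τ => .add (s.subst τ) (t.subst τ)
  | _, _, .mul s t, τ => .mul (s.subst τ) (t.subst τ)

/-- A term, regarded as a term with `k` further variables, which come last. -/
def Term.lift {p : ℕ} (t : Term p) (k : ℕ) : Term (p + k) :=
  t.subst fun i => .var (Fin.castAdd k i)

/-- Simultaneous, capture-free substitution of terms for the free number variables and of set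
variables for the free set variables. -/
def Formula.subst : {p q p' q' : ℕ} → Formula p q → (Fin p → Term p') → (Fin q → Fin q') →
    Formula p' q'
  | _, _, _, _, .eq s t, τ, _ => .eq (s.subst τ) (t.subst τ)
  | _, _, _, _, .lt s t, τ, _ => .lt (s.subst τ) (t.subst τ)
  | _, _, _, _, .mem t X, τ, σ => .mem (t.subst τ) (σ X)
  | _, _, _, _, .neg φ, τ, σ => .neg (φ.subst τ σ)
  | _, _, _, _, .and φ ψ, τ, σ => .and (φ.subst τ σ) (ψ.subst τ σ)
  | _, _, _, _, .or φ ψ, τ, σ => .or (φ.subst τ σ) (ψ.subst τ σ)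
  | _, _, _, _, .imp φ ψ, τ, σ => .imp (φ.subst τ σ) (ψ.subst τ σ)
  | _, _, _, _, .iff φ ψ, τ, σ => .iff (φ.subst τ σ) (ψ.subst τ σ)
  | p, _, p', _, .allN φ, τ, σ => .allN (φ.subst
      (Fin.snoc (α := fun _ : Fin (p + 1) => Term (p' + 1)) (fun i => (τ i).lift 1)
        (.var (Fin.last p'))) σ)
  | p, _, p', _, .exN φ, τ, σ => .exN (φ.subst
      (Fin.snoc (α := fun _ : Fin (p + 1) => Term (p' + 1)) (fun i => (τ i).lift 1)
        (.var (Fin.last p'))) σ)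
  | _, q, _, q', .allS φ, τ, σ => .allS (φ.subst τ
      (Fin.snoc (α := fun _ : Fin (q + 1) => Fin (q' + 1)) (fun i => (σ i).castSucc)
        (Fin.last q')))
  | _, q, _, q', .exS φ, τ, σ => .exS (φ.subst τ
      (Fin.snoc (α := fun _ : Fin (q + 1) => Fin (q' + 1)) (fun i => (σ i).castSucc)
        (Fin.last q')))

/-- Universal closure with respect to the number variables. -/
def Formula.closeN : {p q : ℕ} → Formula p q → Formula 0 q
  | 0, _, φ => φ
  | _ + 1, _, φ => closeN (.allN φ)

/-- Universal closure with respect to the set variables. -/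
def Formula.closeS : {p q : ℕ} → Formula p q → Formula p 0
  | _, 0, φ => φ
  | _, _ + 1, φ => closeS (.allS φ)

/-- The universal closure of a formula. -/
def Formula.close {p q : ℕ} (φ : Formula p q) : Sentence := φ.closeN.closeS

/-- The last number variable, as a term. -/
def Term.last {p : ℕ} : Term (p + 1) := .var (Fin.last p)

/-- `s ≤ t`, that is, `s < t + 1`. -/
def Formula.le {p q : ℕ} (s t : Term p) : Formula p q := .lt s (.add t .one)

/-- `∀ x < t, φ` -/
def Formula.allLt {p q : ℕ} (t : Term p) (φ : Formula (p + 1) q) : Formula p q :=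
  .allN (.imp (.lt .last (t.lift 1)) φ)

/-- `∃ x < t, φ` -/
def Formula.exLt {p q : ℕ} (t : Term p) (φ : Formula (p + 1) q) : Formula p q :=
  .exN (.and (.lt .last (t.lift 1)) φ)

/-- `∀ x ≤ t, φ`, that is, `∀ x < t + 1, φ`. -/
def Formula.allLe {p q : ℕ} (t : Term p) (φ : Formula (p + 1) q) : Formula p q :=
  .allLt (.add t .one) φ

/-- `∃ x ≤ t, φ`, that is, `∃ x < t + 1, φ`. -/
def Formula.exLe {p q : ℕ} (t : Term p) (φ : Formula (p + 1) q) : Formula p q :=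
  .exLt (.add t .one) φ

/-- `∃ x₁ … ∃ x_k, φ` -/
def Formula.exs {p q : ℕ} : (k : ℕ) → Formula (p + k) q → Formula p q
  | 0, φ => φ
  | k + 1, φ => Formula.exs k (.exN φ)

/-- `∃ x₁ ≤ t … ∃ x_k ≤ t, φ` -/
def Formula.exsLe {p q : ℕ} (t : Term p) : (k : ℕ) → Formula (p + k) q → Formula p q
  | 0, φ => φ
  | k + 1, φ => Formula.exsLe t k (.exLe (t.lift k) φ)

/-- `∀ x₁ ≤ t … ∀ x_k ≤ t, φ` -/
def Formula.allsLe {p q : ℕ} (t : Term p) : (k : ℕ) → Formula (p + k) q → Formula p q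
  | 0, φ => φ
  | k + 1, φ => Formula.allsLe t k (.allLe (t.lift k) φ)

/-! ### Classes of formulas -/

/-- `Σ⁰₀` formulas: all quantifiers are bounded number quantifiers. -/
inductive IsSigma00 : {p q : ℕ} → Formula p q → Prop
  | eq {p q : ℕ} (s t : Term p) : IsSigma00 (.eq s t : Formula p q)
  | lt {p q : ℕ} (s t : Term p) : IsSigma00 (.lt s t : Formula p q)
  | mem {p q : ℕ} (t : Term p) (X : Fin q) : IsSigma00 (.mem t X)
  | neg {p q : ℕ} {φ : Formula p q} : IsSigma00 φ → IsSigma00 (.neg φ)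
  | and {p q : ℕ} {φ ψ : Formula p q} : IsSigma00 φ → IsSigma00 ψ → IsSigma00 (.and φ ψ)
  | or {p q : ℕ} {φ ψ : Formula p q} : IsSigma00 φ → IsSigma00 ψ → IsSigma00 (.or φ ψ)
  | imp {p q : ℕ} {φ ψ : Formula p q} : IsSigma00 φ → IsSigma00 ψ → IsSigma00 (.imp φ ψ)
  | iff {p q : ℕ} {φ ψ : Formula p q} : IsSigma00 φ → IsSigma00 ψ → IsSigma00 (.iff φ ψ)
  | allLt {p q : ℕ} (t : Term p) {φ : Formula (p + 1) q} :
      IsSigma00 φ → IsSigma00 (Formula.allLt t φ)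
  | exLt {p q : ℕ} (t : Term p) {φ : Formula (p + 1) q} :
      IsSigma00 φ → IsSigma00 (Formula.exLt t φ)

/-- `Σ⁰₁` formulas: `∃ w₁ … ∃ w_k, θ` with `θ` in `Σ⁰₀`. -/
inductive IsSigma01 : {p q : ℕ} → Formula p q → Prop
  | sigma00 {p q : ℕ} {φ : Formula p q} : IsSigma00 φ → IsSigma01 φ
  | exN {p q : ℕ} {φ : Formula (p + 1) q} : IsSigma01 φ → IsSigma01 (.exN φ)

/-- `Π⁰₁` formulas: `∀ w₁ … ∀ w_k, θ` with `θ` in `Σ⁰₀`. -/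
inductive IsPi01 : {p q : ℕ} → Formula p q → Prop
  | sigma00 {p q : ℕ} {φ : Formula p q} : IsSigma00 φ → IsPi01 φ
  | allN {p q : ℕ} {φ : Formula (p + 1) q} : IsPi01 φ → IsPi01 (.allN φ)

/-! ### RCA₀ -/

/-- The basic axioms. -/
inductive BasicAxiom : Sentence → Prop
  /-- `n + 1 ≠ 0` -/
  | succ_ne_zero : BasicAxiom
      (Formula.close (p := 1) (q := 0) (.neg (.eq (.add (.var 0) .one) .zero)))
  /-- `m + 1 = n + 1 → m = n` -/
  | succ_inj : BasicAxiom
      (Formula.close (p := 2) (q := 0) (.imp (.eq (.add (.var 0) .one) (.add (.var 1) .one))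
        (.eq (.var 0) (.var 1))))
  /-- `m + 0 = m` -/
  | add_zero : BasicAxiom
      (Formula.close (p := 1) (q := 0) (.eq (.add (.var 0) .zero) (.var 0)))
  /-- `m + (n + 1) = (m + n) + 1` -/
  | add_succ : BasicAxiom
      (Formula.close (p := 2) (q := 0) (.eq (.add (.var 0) (.add (.var 1) .one))
        (.add (.add (.var 0) (.var 1)) .one)))
  /-- `m * 0 = 0` -/
  | mul_zero : BasicAxiom
      (Formula.close (p := 1) (q := 0) (.eq (.mul (.var 0) .zero) .zero))
  /-- `m * (n + 1) = m * n + m` -/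
  | mul_succ : BasicAxiom
      (Formula.close (p := 2) (q := 0) (.eq (.mul (.var 0) (.add (.var 1) .one))
        (.add (.mul (.var 0) (.var 1)) (.var 0))))
  /-- `¬ m < 0` -/
  | not_lt_zero : BasicAxiom
      (Formula.close (p := 1) (q := 0) (.neg (.lt (.var 0) .zero)))
  /-- `m < n + 1 ↔ m < n ∨ m = n` -/
  | lt_succ : BasicAxiom
      (Formula.close (p := 2) (q := 0) (.iff (.lt (.var 0) (.add (.var 1) .one))
        (.or (.lt (.var 0) (.var 1)) (.eq (.var 0) (.var 1)))))

/-- `φ(t)`, where `φ` is `φ(x)` with `x` the last number variable, and `t` is a term in `k`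
further variables. -/
def Formula.inst {p q : ℕ} (φ : Formula (p + 1) q) (k : ℕ) (t : Term (p + k)) :
    Formula (p + k) q :=
  φ.subst (Fin.snoc (α := fun _ : Fin (p + 1) => Term (p + k))
    (fun i => .var (Fin.castAdd k i)) t) id

/-- The induction axiom `φ(0) ∧ ∀ x (φ(x) → φ(x + 1)) → ∀ x φ(x)` (universal closure). -/
def inductionAxiom {p q : ℕ} (φ : Formula (p + 1) q) : Sentence :=
  Formula.close (.imp
    (.and (φ.inst 0 .zero) (.allN (.imp φ (φ.inst 1 (.add .last .one)))))
    (.allN φ))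

/-- The comprehension axiom `∀ x (φ(x) ↔ ψ(x)) → ∃ X ∀ x (x ∈ X ↔ φ(x))` (universal closure);
`X` is a new variable. -/
def comprehensionAxiom {p q : ℕ} (φ ψ : Formula (p + 1) q) : Sentence :=
  Formula.close (.imp (.allN (.iff φ ψ))
    (.exS (.allN (.iff (.mem .last (Fin.last q)) (φ.subst .var Fin.castSucc)))))

/-- RCA₀: the basic axioms, `Σ⁰₁` induction and `Δ⁰₁` comprehension. -/
inductive RCA0Axiom : Sentence → Prop
  | basic {φ : Sentence} : BasicAxiom φ → RCA0Axiom φ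
  | induction {p q : ℕ} {φ : Formula (p + 1) q} :
      IsSigma01 φ → RCA0Axiom (inductionAxiom φ)
  | comprehension {p q : ℕ} {φ ψ : Formula (p + 1) q} :
      IsSigma01 φ → IsPi01 ψ → RCA0Axiom (comprehensionAxiom φ ψ)

/-- The theory RCA₀. -/
def RCA0 : Set Sentence := {φ | RCA0Axiom φ}

/-! ### Functions and initial segments -/

/-- The pairing term `(s, t) = (s + t)² + s`. -/
def Term.pair {p : ℕ} (s t : Term p) : Term p :=
  .add (.mul (.add s t) (.add s t)) s

/-- The `i`-th of `r` number variables that follow the first `p` ones. -/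
def newVar (p : ℕ) {r : ℕ} (i : Fin r) : Term (p + r) := .var (Fin.natAdd p i)

/-- `f : ℕ → [n]`, where `[n] = {0, …, n}`: the set `f` consists of pairs `(i, j)` with `j ≤ n`, and
for every `i` there is exactly one `j` with `(i, j) ∈ f`. In symbols:
`∀ m, (m ∈ f → ∃ i, ∃ j, (j ≤ n ∧ m = (i, j)))` and
`∀ i, ∃ j, ((i, j) ∈ f ∧ ∀ k, ((i, k) ∈ f → k = j))`. -/
def Formula.isFun {p q : ℕ} (n : Term p) (f : Fin q) : Formula p q :=
  .and
    (.allN (.imp (.mem (newVar p (0 : Fin 1)) f)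
      (.exN (.exN (.and (.le (newVar p (2 : Fin 3)) (n.lift 3))
        (.eq (newVar p (0 : Fin 3)) (.pair (newVar p (1 : Fin 3)) (newVar p (2 : Fin 3)))))))))
    (.allN (.exN (.and
      (.mem (.pair (newVar p (0 : Fin 2)) (newVar p (1 : Fin 2))) f)
      (.allN (.imp (.mem (.pair (newVar p (0 : Fin 3)) (newVar p (2 : Fin 3))) f)
        (.eq (newVar p (2 : Fin 3)) (newVar p (1 : Fin 3))))))))

/-- `∀ f : ℕ → [n], φ` -/
def Formula.allFun {p q : ℕ} (n : Term p) (φ : Formula p (q + 1)) : Formula p q :=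
  .allS (.imp (.isFun n (Fin.last q)) φ)

/-- For `f g : ℕ → [n]`: the finite sequences `⟨f 0, …, f (y - 1)⟩` and `⟨g 0, …, g (y - 1)⟩` are
equal, that is, `∀ i < y, ∀ j ≤ n, ((i, j) ∈ f ↔ (i, j) ∈ g)`. -/
def Formula.agree {p q : ℕ} (n y : Term p) (f g : Fin q) : Formula p q :=
  .allLt y (.allLe (n.lift 1) (.iff
    (.mem (.pair (newVar p (0 : Fin 2)) (newVar p (1 : Fin 2))) f)
    (.mem (.pair (newVar p (0 : Fin 2)) (newVar p (1 : Fin 2))) g)))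

/-! ### CUB and CUB′

Below, `A` is a formula `A(f, x₁, …, x_k)`: its number variables are `p` parameters followed by
`x₁, …, x_k`, and its set variables are `q` parameters followed by `f`. -/

/-- `A(h, x₁, …, x_k)` in a context where `r` number variables were introduced between the
parameters and `x₁, …, x_k`, and `s` set variables, among them `h`, after the parameters. -/
def Formula.atFun {p k q : ℕ} (A : Formula (p + k) (q + 1)) (r s : ℕ) (h : Fin (q + s)) :
    Formula (p + r + k) (q + s) :=
  A.subst
    (Fin.append (fun i : Fin p => Term.var (Fin.castAdd k (Fin.castAdd r i)))
      (fun j : Fin k => Term.var (Fin.natAdd (p + r) j)))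
    (Fin.snoc (α := fun _ : Fin (q + 1) => Fin (q + s)) (Fin.castAdd s) h)

/-- `cont(A)`, with `n` the number variable that follows the parameters:
`∀ f : ℕ → [n], ∀ z, ∃ y, ∀ g : ℕ → [n], (f̄ y = ḡ y → ∀ x ≤ z, (A(f, x) ↔ A(g, x)))`. -/
def Formula.cont {p k q : ℕ} (A : Formula (p + k) (q + 1)) : Formula (p + 1) q :=
  .allFun (newVar p (0 : Fin 1)) (.allN (.exN (.allFun (newVar p (0 : Fin 3))
    (.imp
      (.agree (newVar p (0 : Fin 3)) (newVar p (2 : Fin 3))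
        (Fin.natAdd q (0 : Fin 2)) (Fin.natAdd q (1 : Fin 2)))
      (.allsLe (newVar p (1 : Fin 3)) k
        (.iff (A.atFun 3 2 (Fin.natAdd q (0 : Fin 2)))
          (A.atFun 3 2 (Fin.natAdd q (1 : Fin 2)))))))))

/-- `∀ f : ℕ → [n], ∃ x, A(f, x)`, with `n` the number variable that follows the parameters. -/
def Formula.total {p k q : ℕ} (A : Formula (p + k) (q + 1)) : Formula (p + 1) q :=
  .allFun (newVar p (0 : Fin 1)) (.exs k (A.atFun 1 1 (Fin.last q)))

/-- The instance of CUB for `A` (universal closure):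
`∀ n, (cont(A) ∧ ∀ f : ℕ → [n], ∃ x, A(f, x)) → ∃ z, ∀ f : ℕ → [n], ∃ x ≤ z, A(f, x)`. -/
def cubInstance {p k q : ℕ} (A : Formula (p + k) (q + 1)) : Sentence :=
  Formula.close (p := p) (q := q) (.allN (.imp (.and A.cont A.total)
    (.exN (.allFun (newVar p (0 : Fin 2))
      (.exsLe (newVar p (1 : Fin 2)) k (A.atFun 2 1 (Fin.last q)))))))

/-- The instance of CUB′ for `A` (universal closure):
`∀ n, (cont(A) ∧ ∀ f : ℕ → [n], ∃ x, A(f, x)) →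
  ∃ z, ∀ f : ℕ → [n], ∃ x ≤ z, (A(f, x) ∧ ∀ g : ℕ → [n], (f̄ z = ḡ z → A(g, x)))`. -/
def cubPrimeInstance {p k q : ℕ} (A : Formula (p + k) (q + 1)) : Sentence :=
  Formula.close (p := p) (q := q) (.allN (.imp (.and A.cont A.total)
    (.exN (.allFun (newVar p (0 : Fin 2))
      (.exsLe (newVar p (1 : Fin 2)) k
        (.and (A.atFun 2 1 (Fin.last q))
          (.allFun ((newVar p (0 : Fin 2)).lift k)
            (.imp
              (.agree ((newVar p (0 : Fin 2)).lift k) ((newVar p (1 : Fin 2)).lift k)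
                (Fin.natAdd q (0 : Fin 2)) (Fin.natAdd q (1 : Fin 2)))
              (A.atFun 2 2 (Fin.natAdd q (1 : Fin 2)))))))))))

/-- The schema `Γ`-CUB. -/
def CUB (Γ : ∀ {p q : ℕ}, Formula p q → Prop) : Set Sentence :=
  {φ | ∃ (p k q : ℕ) (A : Formula (p + k) (q + 1)), Γ A ∧ φ = cubInstance A}

/-- The schema `Γ`-CUB′. -/
def CUBPrime (Γ : ∀ {p q : ℕ}, Formula p q → Prop) : Set Sentence :=
  {φ | ∃ (p k q : ℕ) (A : Formula (p + k) (q + 1)), Γ A ∧ φ = cubPrimeInstance A}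

/-- The class of all formulas. -/
def AnyFormula {p q : ℕ} (_ : Formula p q) : Prop := True

end SOA

namespace SOA

variable {M : Structure.{u}}

/-! ### Semantics of substitution and of the abbreviations -/

/-! CUB′ implies CUB by dropping the last clause of its conclusion. For the converse with Π⁰₁ or
arbitrary formulas, CUB is applied not to A but to the formula B(f, x, y) saying that A(g, x) holds
for all g : ℕ → [n] with f̄ y = ḡ y, where y joins the tuple and n joins the parameters. B is
continuous for a trivial reason: for y ≤ z it depends on f only below z. It is total because A is
total and a modulus of continuity of A at f serves as y. A bound z for B is one for CUB′: taking g =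
f gives A(f, x), and agreement up to z implies agreement up to y ≤ z. This is
`Structure.StronglyBounded.of_stability`.

If A is Π⁰₁, then B has to be Π⁰₁ again, so its set quantifier must be replaced by number
quantifiers. The leading universal quantifiers of A commute with ∀ g, and a Σ⁰₀ formula looks at a
finite part of g only (`IsSigma00.exists_use`), so that g may be replaced by a function coded by two
numbers (`exists_codeFun`, `IsSigma00.forall_fun_iff`). The coding is Gödel's, by divisibility by
the numbers 1 + (u + 1) b, and is developed from Σ⁰₁ induction (`exists_code`).

If A is Σ⁰₀, then B need not be, but CUB for A itself is enough: once x ≤ z, the truth of A(f, x)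
depends only on f below some T that does not depend on f, and max z T is a bound for CUB′. -/

theorem Term.val_subst {p p' : ℕ} (t : Term p) (τ : Fin p → Term p') (e : Fin p' → M.carrier) :
    (t.subst τ).val M e = t.val M fun i => (τ i).val M e := by
  induction t with
  | var i => simp only [Term.subst, Term.val]
  | zero => simp only [Term.subst, Term.val]
  | one => simp only [Term.subst, Term.val]
  | add s t hs ht => simp only [Term.subst, Term.val, hs, ht]
  | mul s t hs ht => simp only [Term.subst, Term.val, hs, ht]

theorem Term.val_lift {p : ℕ} (t : Term p) (k : ℕ) (e : Fin (p + k) → M.carrier) :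
    (t.lift k).val M e = t.val M fun i => e (Fin.castAdd k i) := by
  rw [Term.lift, Term.val_subst]
  simp only [Term.val]

@[simp]
theorem Term.val_lift_one {p : ℕ} (t : Term p) (e : Fin p → M.carrier) (a : M.carrier) :
    (t.lift 1).val M (Fin.snoc (α := fun _ : Fin (p + 1) => M.carrier) e a) = t.val M e := by
  rw [Term.val_lift]
  congr 1
  funext i
  exact Fin.snoc_castSucc (α := fun _ : Fin (p + 1) => M.carrier) _ _ _

@[simp]
theorem Term.val_lift_append {p k : ℕ} (t : Term p) (e : Fin p → M.carrier)
    (x : Fin k → M.carrier) : (t.lift k).val M (Fin.append e x) = t.val M e := by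
  rw [Term.val_lift]
  simp only [Fin.append_left]

@[simp]
theorem Term.val_last {p : ℕ} (e : Fin p → M.carrier) (a : M.carrier) :
    (Term.last : Term (p + 1)).val M (Fin.snoc (α := fun _ : Fin (p + 1) => M.carrier) e a) = a := by
  simp [Term.last, Term.val]

theorem snoc_comp {α β : Type*} {p : ℕ} (g : α → β) (τ : Fin p → α) (a : α) :
    (fun i => g (Fin.snoc (α := fun _ : Fin (p + 1) => α) τ a i)) =
      Fin.snoc (α := fun _ : Fin (p + 1) => β) (fun i => g (τ i)) (g a) := by
  funext i
  refine Fin.lastCases ?_ (fun i => ?_) i <;> simp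

theorem Formula.sat_subst {p q p' q' : ℕ} (φ : Formula p q) (τ : Fin p → Term p')
    (σ : Fin q → Fin q') (e : Fin p' → M.carrier) (E : Fin q' → M.sets) :
    (φ.subst τ σ).Sat M e E ↔ φ.Sat M (fun i => (τ i).val M e) fun i => E (σ i) := by
  induction φ generalizing p' q' with
  | eq s t => simp only [Formula.subst, Formula.Sat, Term.val_subst]
  | lt s t => simp only [Formula.subst, Formula.Sat, Term.val_subst]
  | mem t X => simp only [Formula.subst, Formula.Sat, Term.val_subst]
  | neg φ h => simp only [Formula.subst, Formula.Sat, h]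
  | and φ ψ h h' => simp only [Formula.subst, Formula.Sat, h, h']
  | or φ ψ h h' => simp only [Formula.subst, Formula.Sat, h, h']
  | imp φ ψ h h' => simp only [Formula.subst, Formula.Sat, h, h']
  | iff φ ψ h h' => simp only [Formula.subst, Formula.Sat, h, h']
  | allN φ h =>
    simp only [Formula.subst, Formula.Sat, h]
    refine forall_congr' fun a => ?_
    rw [snoc_comp (fun t : Term (p' + 1) => t.val M _)]
    simp [Term.val]
  | exN φ h =>
    simp only [Formula.subst, Formula.Sat, h]
    refine exists_congr fun a => ?_
    rw [snoc_comp (fun t : Term (p' + 1) => t.val M _)]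
    simp [Term.val]
  | allS φ h =>
    simp only [Formula.subst, Formula.Sat, h]
    refine forall_congr' fun X => ?_
    rw [snoc_comp (Fin.snoc (α := fun _ : Fin (q' + 1) => M.sets) E X)]
    simp
  | exS φ h =>
    simp only [Formula.subst, Formula.Sat, h]
    refine exists_congr fun X => ?_
    rw [snoc_comp (Fin.snoc (α := fun _ : Fin (q' + 1) => M.sets) E X)]
    simp

theorem Formula.sat_closeN {p q : ℕ} (φ : Formula p q) (E : Fin q → M.sets) :
    φ.closeN.Sat M Fin.elim0 E ↔ ∀ e, φ.Sat M e E := by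
  induction p with
  | zero => simp [Formula.closeN, Subsingleton.elim _ Fin.elim0]
  | succ p ih =>
    rw [Formula.closeN, ih]
    refine ⟨fun h e => ?_, fun h e a => h _⟩
    rw [← Fin.snoc_init_self (α := fun _ : Fin (p + 1) => M.carrier) e]
    exact h _ _

theorem Formula.sat_closeS {p q : ℕ} (φ : Formula p q) (e : Fin p → M.carrier) :
    φ.closeS.Sat M e Fin.elim0 ↔ ∀ E, φ.Sat M e E := by
  induction q with
  | zero => simp [Formula.closeS, Subsingleton.elim _ Fin.elim0]
  | succ q ih =>
    rw [Formula.closeS, ih]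
    refine ⟨fun h e => ?_, fun h e a => h _⟩
    rw [← Fin.snoc_init_self (α := fun _ : Fin (q + 1) => M.sets) e]
    exact h _ _

theorem Structure.models_close {p q : ℕ} (φ : Formula p q) :
    M.Models φ.close ↔ ∀ e E, φ.Sat M e E := by
  rw [Structure.Models, Formula.close, Formula.sat_closeS]
  simp only [Formula.sat_closeN]
  exact forall_comm

theorem Formula.sat_allLt {p q : ℕ} (t : Term p) (φ : Formula (p + 1) q) (e : Fin p → M.carrier)
    (E : Fin q → M.sets) : (Formula.allLt t φ).Sat M e E ↔ ∀ a, M.lt a (t.val M e) →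
      φ.Sat M (Fin.snoc (α := fun _ : Fin (p + 1) => M.carrier) e a) E := by
  simp only [Formula.allLt, Formula.Sat, Term.val_last, Term.val_lift_one]

theorem Formula.sat_exLt {p q : ℕ} (t : Term p) (φ : Formula (p + 1) q) (e : Fin p → M.carrier)
    (E : Fin q → M.sets) : (Formula.exLt t φ).Sat M e E ↔ ∃ a, M.lt a (t.val M e) ∧
      φ.Sat M (Fin.snoc (α := fun _ : Fin (p + 1) => M.carrier) e a) E := by
  simp only [Formula.exLt, Formula.Sat, Term.val_last, Term.val_lift_one]

theorem append_snoc {α : Type*} {p k : ℕ} (e : Fin p → α) (x : Fin k → α) (a : α) :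
    Fin.append e (Fin.snoc (α := fun _ : Fin (k + 1) => α) x a) =
      Fin.snoc (α := fun _ : Fin (p + k + 1) => α) (Fin.append e x) a :=
  Fin.append_snoc _ _ _

theorem Formula.sat_exs {p k q : ℕ} (φ : Formula (p + k) q) (e : Fin p → M.carrier)
    (E : Fin q → M.sets) :
    (Formula.exs k φ).Sat M e E ↔ ∃ x : Fin k → M.carrier, φ.Sat M (Fin.append e x) E := by
  induction k with
  | zero => simp [Formula.exs, Fin.append_right_nil]
  | succ k ih =>
    rw [Formula.exs, ih]
    constructor
    · rintro ⟨x, a, h⟩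
      exact ⟨Fin.snoc (α := fun _ : Fin (k + 1) => M.carrier) x a, by rwa [append_snoc]⟩
    · rintro ⟨x, h⟩
      refine ⟨Fin.init x, x (Fin.last k), ?_⟩
      rwa [← append_snoc, Fin.snoc_init_self]

theorem Formula.sat_exsLe {p k q : ℕ} (t : Term p) (φ : Formula (p + k) q) (e : Fin p → M.carrier)
    (E : Fin q → M.sets) : (Formula.exsLe t k φ).Sat M e E ↔
      ∃ x : Fin k → M.carrier, (∀ i, M.lt (x i) (M.add (t.val M e) M.one)) ∧
        φ.Sat M (Fin.append e x) E := by
  induction k with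
  | zero => simp [Formula.exsLe, Fin.append_right_nil]
  | succ k ih =>
    rw [Formula.exsLe, ih]
    simp only [Formula.exLe, Formula.sat_exLt, Term.val, Term.val_lift_append]
    constructor
    · rintro ⟨x, hx, a, ha, h⟩
      refine ⟨Fin.snoc (α := fun _ : Fin (k + 1) => M.carrier) x a, fun i => ?_,
        by rwa [append_snoc]⟩
      refine Fin.lastCases ?_ (fun i => ?_) i <;> simp [ha, hx]
    · rintro ⟨x, hx, h⟩
      refine ⟨Fin.init x, fun i => hx _, x (Fin.last k), hx _, ?_⟩
      rwa [← append_snoc, Fin.snoc_init_self]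

theorem Formula.sat_allsLe {p k q : ℕ} (t : Term p) (φ : Formula (p + k) q)
    (e : Fin p → M.carrier) (E : Fin q → M.sets) : (Formula.allsLe t k φ).Sat M e E ↔
      ∀ x : Fin k → M.carrier, (∀ i, M.lt (x i) (M.add (t.val M e) M.one)) →
        φ.Sat M (Fin.append e x) E := by
  induction k with
  | zero => simp [Formula.allsLe, Fin.append_right_nil]
  | succ k ih =>
    rw [Formula.allsLe, ih]
    simp only [Formula.allLe, Formula.sat_allLt, Term.val, Term.val_lift_append]
    constructor
    · intro h x hx
      have := h (Fin.init x) (fun i => hx _) (x (Fin.last k)) (hx _)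
      rwa [← append_snoc, Fin.snoc_init_self] at this
    · intro h x hx a ha
      rw [← append_snoc]
      refine h _ fun i => ?_
      refine Fin.lastCases ?_ (fun i => ?_) i <;> simp [ha, hx]

/-! ### Functions, initial segments and the schemata, semantically -/

/-- The code of the pair `(i, j)` in a structure. -/
def Structure.pair (M : Structure.{u}) (i j : M.carrier) : M.carrier :=
  M.add (M.mul (M.add i j) (M.add i j)) i

/-- The meaning of `Formula.isFun`. -/
def Structure.IsFun (M : Structure.{u}) (n : M.carrier) (F : M.sets) : Prop :=
  (∀ m, m ∈ F.1 → ∃ i j, M.lt j (M.add n M.one) ∧ m = M.pair i j) ∧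
    ∀ i, ∃ j, M.pair i j ∈ F.1 ∧ ∀ k, M.pair i k ∈ F.1 → k = j

/-- The meaning of `Formula.agree`. -/
def Structure.Agree (M : Structure.{u}) (n y : M.carrier) (F G : M.sets) : Prop :=
  ∀ i, M.lt i y → ∀ j, M.lt j (M.add n M.one) → (M.pair i j ∈ F.1 ↔ M.pair i j ∈ G.1)

/-- The meaning of the condition `x₁, …, x_k ≤ z`. -/
def Structure.AllLe (M : Structure.{u}) {k : ℕ} (x : Fin k → M.carrier) (z : M.carrier) : Prop :=
  ∀ i, M.lt (x i) (M.add z M.one)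

/-- Reduces the lookup of a variable under nested quantifiers to comparisons of positions, which
`simp` can decide. -/
theorem snoc_val {α : Type*} {p : ℕ} (e : Fin p → α) (a : α) (i : Fin (p + 1)) :
    Fin.snoc (α := fun _ : Fin (p + 1) => α) e a i = if h : i.1 < p then e ⟨i, h⟩ else a := by
  simp only [Fin.snoc, cast_eq]
  rfl

theorem Formula.sat_isFun {p q : ℕ} (n : Term p) (f : Fin q) (e : Fin p → M.carrier)
    (E : Fin q → M.sets) : (Formula.isFun n f).Sat M e E ↔ M.IsFun (n.val M e) (E f) := by
  have h (i : Fin p) : (i : ℕ) ≤ p + 1 := by omega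
  simp [Formula.isFun, Structure.IsFun, Formula.Sat, Formula.le, Term.pair, newVar, Term.val,
    Structure.pair, Term.val_lift, snoc_val, h]

theorem Formula.sat_agree {p q : ℕ} (n y : Term p) (f g : Fin q) (e : Fin p → M.carrier)
    (E : Fin q → M.sets) :
    (Formula.agree n y f g).Sat M e E ↔ M.Agree (n.val M e) (y.val M e) (E f) (E g) := by
  simp [Formula.agree, Structure.Agree, Formula.Sat, Formula.allLe, Formula.sat_allLt, Term.pair,
    newVar, Term.val, Structure.pair, snoc_val]

end SOA

namespace SOA

variable {M : Structure.{u}}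

/-- The relation `R` between tuples and functions `ℕ → [n]` is continuous in the function. -/
def Structure.Cont (M : Structure.{u}) (n : M.carrier) {k : ℕ}
    (R : (Fin k → M.carrier) → M.sets → Prop) : Prop :=
  ∀ f, M.IsFun n f → ∀ z, ∃ y, ∀ g, M.IsFun n g → M.Agree n y f g →
    ∀ x, M.AllLe x z → (R x f ↔ R x g)

/-- Every function `ℕ → [n]` is related to some tuple. -/
def Structure.Total (M : Structure.{u}) (n : M.carrier) {k : ℕ}
    (R : (Fin k → M.carrier) → M.sets → Prop) : Prop :=
  ∀ f, M.IsFun n f → ∃ x, R x f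

/-- The conclusion of CUB. -/
def Structure.Bounded (M : Structure.{u}) (n : M.carrier) {k : ℕ}
    (R : (Fin k → M.carrier) → M.sets → Prop) : Prop :=
  ∃ z, ∀ f, M.IsFun n f → ∃ x, M.AllLe x z ∧ R x f

/-- The conclusion of CUB′. -/
def Structure.StronglyBounded (M : Structure.{u}) (n : M.carrier) {k : ℕ}
    (R : (Fin k → M.carrier) → M.sets → Prop) : Prop :=
  ∃ z, ∀ f, M.IsFun n f → ∃ x, M.AllLe x z ∧
    (R x f ∧ ∀ g, M.IsFun n g → M.Agree n z f g → R x g)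

/-- The relation defined by a formula `A(f, x₁, …, x_k)` with given values of the parameters. -/
def Formula.rel {p k q : ℕ} (A : Formula (p + k) (q + 1)) (e : Fin p → M.carrier)
    (E : Fin q → M.sets) (x : Fin k → M.carrier) (f : M.sets) : Prop :=
  A.Sat M (Fin.append e x) (Fin.snoc (α := fun _ : Fin (q + 1) => M.sets) E f)

theorem Formula.sat_atFun {p k q : ℕ} (A : Formula (p + k) (q + 1)) (r s : ℕ) (h : Fin (q + s))
    (e : Fin (p + r) → M.carrier) (E : Fin (q + s) → M.sets) (x : Fin k → M.carrier) :
    (A.atFun r s h).Sat M (Fin.append e x) E ↔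
      A.rel (fun i => e (Fin.castAdd r i)) (fun i => E (Fin.castAdd s i)) x (E h) := by
  rw [Formula.atFun, Formula.sat_subst, Formula.rel, snoc_comp]
  refine iff_of_eq (congrArg (fun e => A.Sat M e _) ?_)
  funext i
  refine Fin.addCases (fun i => ?_) (fun i => ?_) i <;> simp [Term.val]

theorem Formula.sat_allFun {p q : ℕ} (n : Term p) (φ : Formula p (q + 1)) (e : Fin p → M.carrier)
    (E : Fin q → M.sets) : (Formula.allFun n φ).Sat M e E ↔ ∀ f, M.IsFun (n.val M e) f →
      φ.Sat M e (Fin.snoc (α := fun _ : Fin (q + 1) => M.sets) E f) := by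
  simp [Formula.allFun, Formula.Sat, Formula.sat_isFun]

theorem Formula.sat_cont {p k q : ℕ} (A : Formula (p + k) (q + 1)) (e : Fin p → M.carrier)
    (E : Fin q → M.sets) (n : M.carrier) :
    A.cont.Sat M (Fin.snoc (α := fun _ : Fin (p + 1) => M.carrier) e n) E ↔
      M.Cont n (A.rel e E) := by
  have h (i : Fin p) : (i : ℕ) ≤ p + 1 := by omega
  simp [h, Formula.cont, Structure.Cont, Formula.sat_allFun, Formula.Sat, Formula.sat_agree,
    Formula.sat_allsLe, Formula.sat_atFun, newVar, Term.val, snoc_val, Structure.AllLe]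

theorem Formula.sat_total {p k q : ℕ} (A : Formula (p + k) (q + 1)) (e : Fin p → M.carrier)
    (E : Fin q → M.sets) (n : M.carrier) :
    A.total.Sat M (Fin.snoc (α := fun _ : Fin (p + 1) => M.carrier) e n) E ↔
      M.Total n (A.rel e E) := by
  simp [Formula.total, Structure.Total, Formula.sat_allFun, Formula.sat_exs,
    Formula.sat_atFun, newVar, Term.val, snoc_val]

/-- Together with `models_cubPrimeInstance`, this removes the syntax: what remains is a statement
about the relation `A.rel e E`. Syntax matters again only for the complexity of formulas. -/
theorem models_cubInstance {p k q : ℕ} (A : Formula (p + k) (q + 1)) :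
    M.Models (cubInstance A) ↔ ∀ (e : Fin p → M.carrier) (E : Fin q → M.sets) (n : M.carrier),
      M.Cont n (A.rel e E) → M.Total n (A.rel e E) → M.Bounded n (A.rel e E) := by
  simp [cubInstance, Structure.models_close, Formula.Sat, Formula.sat_cont, Formula.sat_total,
    Structure.Bounded, Formula.sat_allFun, Formula.sat_exsLe, Formula.sat_atFun, newVar, Term.val,
    snoc_val, Structure.AllLe]

theorem models_cubPrimeInstance {p k q : ℕ} (A : Formula (p + k) (q + 1)) :
    M.Models (cubPrimeInstance A) ↔
      ∀ (e : Fin p → M.carrier) (E : Fin q → M.sets) (n : M.carrier),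
        M.Cont n (A.rel e E) → M.Total n (A.rel e E) → M.StronglyBounded n (A.rel e E) := by
  simp [cubPrimeInstance, Structure.models_close, Formula.Sat, Formula.sat_cont,
    Formula.sat_total, Structure.StronglyBounded, Formula.sat_allFun, Formula.sat_exsLe,
    Formula.sat_agree, Formula.sat_atFun, newVar, Term.val, snoc_val, Structure.AllLe]

end SOA

namespace SOA

variable {M : Structure.{u}}

/-! ### Definable relations in a structure -/

instance : Zero M.carrier := ⟨M.zero⟩
instance : One M.carrier := ⟨M.one⟩
instance : Add M.carrier := ⟨M.add⟩
instance : Mul M.carrier := ⟨M.mul⟩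
instance : LT M.carrier := ⟨M.lt⟩

theorem Structure.zero_eq : M.zero = 0 := rfl
theorem Structure.one_eq : M.one = 1 := rfl
theorem Structure.add_eq (a b : M.carrier) : M.add a b = a + b := rfl
theorem Structure.mul_eq (a b : M.carrier) : M.mul a b = a * b := rfl
theorem Structure.lt_iff (a b : M.carrier) : M.lt a b ↔ a < b := Iff.rfl

/-- The function of the number variables is the value of a term. -/
def TermDef (M : Structure.{u}) {p : ℕ} (t : (Fin p → M.carrier) → M.carrier) : Prop :=
  ∃ s : Term p, ∀ e, s.val M e = t e

/-- The relation is defined by a `Σ⁰₀` formula. -/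
def Sigma00Def (M : Structure.{u}) {p q : ℕ}
    (P : (Fin p → M.carrier) → (Fin q → M.sets) → Prop) : Prop :=
  ∃ φ : Formula p q, IsSigma00 φ ∧ ∀ e E, φ.Sat M e E ↔ P e E

/-- The relation is defined by a `Σ⁰₁` formula. -/
def Sigma01Def (M : Structure.{u}) {p q : ℕ}
    (P : (Fin p → M.carrier) → (Fin q → M.sets) → Prop) : Prop :=
  ∃ φ : Formula p q, IsSigma01 φ ∧ ∀ e E, φ.Sat M e E ↔ P e E

section

variable {p q : ℕ} {s t : (Fin p → M.carrier) → M.carrier}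
  {P Q : (Fin p → M.carrier) → (Fin q → M.sets) → Prop}

theorem TermDef.var (i : Fin p) : TermDef M fun e => e i := ⟨.var i, fun _ => by rw [Term.val]⟩

theorem TermDef.zero : TermDef M fun _ : Fin p → M.carrier => 0 :=
  ⟨.zero, fun _ => by rw [Term.val]; rfl⟩

theorem TermDef.one : TermDef M fun _ : Fin p → M.carrier => 1 :=
  ⟨.one, fun _ => by rw [Term.val]; rfl⟩

theorem TermDef.add (hs : TermDef M s) (ht : TermDef M t) : TermDef M fun e => s e + t e := by
  obtain ⟨s', hs⟩ := hs
  obtain ⟨t', ht⟩ := ht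
  exact ⟨.add s' t', fun e => by rw [Term.val, hs, ht]; rfl⟩

theorem TermDef.mul (hs : TermDef M s) (ht : TermDef M t) : TermDef M fun e => s e * t e := by
  obtain ⟨s', hs⟩ := hs
  obtain ⟨t', ht⟩ := ht
  exact ⟨.mul s' t', fun e => by rw [Term.val, hs, ht]; rfl⟩

theorem Sigma00Def.eq (hs : TermDef M s) (ht : TermDef M t) :
    Sigma00Def M fun e (_ : Fin q → M.sets) => s e = t e := by
  obtain ⟨s', hs⟩ := hs
  obtain ⟨t', ht⟩ := ht
  exact ⟨.eq s' t', .eq _ _, fun e E => by rw [Formula.Sat, hs, ht]⟩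

theorem Sigma00Def.lt (hs : TermDef M s) (ht : TermDef M t) :
    Sigma00Def M fun e (_ : Fin q → M.sets) => s e < t e := by
  obtain ⟨s', hs⟩ := hs
  obtain ⟨t', ht⟩ := ht
  exact ⟨.lt s' t', .lt _ _, fun e E => by rw [Formula.Sat, hs, ht]; rfl⟩

theorem Sigma00Def.mem (ht : TermDef M t) (X : Fin q) :
    Sigma00Def M fun e (E : Fin q → M.sets) => t e ∈ (E X).1 := by
  obtain ⟨t', ht⟩ := ht
  exact ⟨.mem t' X, .mem _ _, fun e E => by rw [Formula.Sat, ht]⟩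

theorem Sigma00Def.not (hP : Sigma00Def M P) : Sigma00Def M fun e E => ¬ P e E := by
  obtain ⟨φ, hφ, hP⟩ := hP
  exact ⟨.neg φ, .neg hφ, fun e E => by rw [Formula.Sat, hP]⟩

theorem Sigma00Def.and (hP : Sigma00Def M P) (hQ : Sigma00Def M Q) :
    Sigma00Def M fun e E => P e E ∧ Q e E := by
  obtain ⟨φ, hφ, hP⟩ := hP
  obtain ⟨ψ, hψ, hQ⟩ := hQ
  exact ⟨.and φ ψ, .and hφ hψ, fun e E => by rw [Formula.Sat, hP, hQ]⟩

theorem Sigma00Def.or (hP : Sigma00Def M P) (hQ : Sigma00Def M Q) :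
    Sigma00Def M fun e E => P e E ∨ Q e E := by
  obtain ⟨φ, hφ, hP⟩ := hP
  obtain ⟨ψ, hψ, hQ⟩ := hQ
  exact ⟨.or φ ψ, .or hφ hψ, fun e E => by rw [Formula.Sat, hP, hQ]⟩

theorem Sigma00Def.imp (hP : Sigma00Def M P) (hQ : Sigma00Def M Q) :
    Sigma00Def M fun e E => P e E → Q e E := by
  obtain ⟨φ, hφ, hP⟩ := hP
  obtain ⟨ψ, hψ, hQ⟩ := hQ
  exact ⟨.imp φ ψ, .imp hφ hψ, fun e E => by rw [Formula.Sat, hP, hQ]⟩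

theorem Sigma00Def.iff (hP : Sigma00Def M P) (hQ : Sigma00Def M Q) :
    Sigma00Def M fun e E => (P e E ↔ Q e E) := by
  obtain ⟨φ, hφ, hP⟩ := hP
  obtain ⟨ψ, hψ, hQ⟩ := hQ
  exact ⟨.iff φ ψ, .iff hφ hψ, fun e E => by rw [Formula.Sat, hP, hQ]⟩

theorem Sigma00Def.all_lt {R : (Fin p → M.carrier) → (Fin q → M.sets) → M.carrier → Prop}
    (ht : TermDef M t)
    (hR : Sigma00Def M fun (e : Fin (p + 1) → M.carrier) E => R (Fin.init e) E (e (Fin.last p))) :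
    Sigma00Def M fun e E => ∀ a, a < t e → R e E a := by
  obtain ⟨t', ht⟩ := ht
  obtain ⟨φ, hφ, hR⟩ := hR
  exact ⟨_, .allLt t' hφ, fun e E => by simp [Formula.sat_allLt, ht, hR, Structure.lt_iff]⟩

theorem Sigma00Def.ex_lt {R : (Fin p → M.carrier) → (Fin q → M.sets) → M.carrier → Prop}
    (ht : TermDef M t)
    (hR : Sigma00Def M fun (e : Fin (p + 1) → M.carrier) E => R (Fin.init e) E (e (Fin.last p))) :
    Sigma00Def M fun e E => ∃ a, a < t e ∧ R e E a := by
  obtain ⟨t', ht⟩ := ht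
  obtain ⟨φ, hφ, hR⟩ := hR
  exact ⟨_, .exLt t' hφ, fun e E => by simp [Formula.sat_exLt, ht, hR, Structure.lt_iff]⟩

theorem Sigma00Def.sigma01Def (hP : Sigma00Def M P) : Sigma01Def M P := by
  obtain ⟨φ, hφ, hP⟩ := hP
  exact ⟨φ, .sigma00 hφ, hP⟩

theorem Sigma01Def.ex {R : (Fin p → M.carrier) → (Fin q → M.sets) → M.carrier → Prop}
    (hR : Sigma01Def M fun (e : Fin (p + 1) → M.carrier) E => R (Fin.init e) E (e (Fin.last p))) :
    Sigma01Def M fun e E => ∃ a, R e E a := by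
  obtain ⟨φ, hφ, hR⟩ := hR
  exact ⟨_, .exN hφ, fun e E => by simp [Formula.Sat, hR]⟩

end

/-! ### Arithmetic in models of `RCA₀` -/

/-- The structure is a model of `RCA₀`. -/
class ModelsRCA0 (M : Structure.{u}) : Prop where
  models : ∀ φ ∈ RCA0, M.Models φ

theorem Formula.sat_inst {p q : ℕ} (φ : Formula (p + 1) q) (k : ℕ) (t : Term (p + k))
    (e : Fin (p + k) → M.carrier) (E : Fin q → M.sets) : (φ.inst k t).Sat M e E ↔
      φ.Sat M (Fin.snoc (α := fun _ : Fin (p + 1) => M.carrier)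
        (fun i => e (Fin.castAdd k i)) (t.val M e)) E := by
  rw [Formula.inst, Formula.sat_subst, snoc_comp (fun t : Term (p + k) => t.val M e)]
  simp [Term.val]

variable [ModelsRCA0 M]

theorem sigma01_induction {p q : ℕ}
    {R : (Fin p → M.carrier) → (Fin q → M.sets) → M.carrier → Prop}
    (hR : Sigma01Def M fun (e : Fin (p + 1) → M.carrier) E => R (Fin.init e) E (e (Fin.last p)))
    (e : Fin p → M.carrier) (E : Fin q → M.sets) (h0 : R e E 0)
    (hs : ∀ a, R e E a → R e E (a + 1)) (a : M.carrier) : R e E a := by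
  obtain ⟨φ, hφ, hR⟩ := hR
  have h := ModelsRCA0.models (M := M) _ (RCA0Axiom.induction hφ)
  rw [inductionAxiom, Structure.models_close] at h
  have := h e E
  simp only [Formula.Sat, Formula.sat_inst, hR, Term.val, Term.val_last] at this
  have h (a : M.carrier) : (fun i => Fin.snoc (α := fun _ : Fin (p + 1) => M.carrier) e a
      (Fin.castAdd 1 i)) = e := by
    funext i
    exact Fin.snoc_castSucc (α := fun _ : Fin (p + 1) => M.carrier) _ _ _
  simp only [Fin.init_snoc, Fin.snoc_last, h] at this
  simpa using this ⟨h0, fun a ha => hs a (by simpa using ha)⟩ a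

theorem sigma00_comprehension {p q : ℕ}
    {R : (Fin p → M.carrier) → (Fin q → M.sets) → M.carrier → Prop}
    (hR : Sigma00Def M fun (e : Fin (p + 1) → M.carrier) E => R (Fin.init e) E (e (Fin.last p)))
    (e : Fin p → M.carrier) (E : Fin q → M.sets) : {a | R e E a} ∈ M.sets := by
  obtain ⟨φ, hφ, hR⟩ := hR
  -- A Σ⁰₀ formula is both Σ⁰₁ and Π⁰₁, so it can play both roles in Δ⁰₁ comprehension.
  have h := ModelsRCA0.models (M := M) _ (RCA0Axiom.comprehension (.sigma00 hφ) (.sigma00 hφ))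
  rw [comprehensionAxiom, Structure.models_close] at h
  have := h e E
  simp only [Formula.Sat, Formula.sat_subst, hR, Term.val, Term.val_last, implies_true,
    forall_const] at this
  obtain ⟨X, hX⟩ := this
  convert X.2
  ext a
  have := hX a
  simp at this
  exact this.symm

theorem Structure.models_basic {φ : Sentence} (h : BasicAxiom φ) : M.Models φ :=
  ModelsRCA0.models φ (.basic h)

namespace Arith

theorem succ_ne_zero (a : M.carrier) : a + 1 ≠ 0 := by
  have h := Structure.models_basic (M := M) .succ_ne_zero
  rw [Structure.models_close] at h
  have := h ![a] Fin.elim0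
  simpa [Formula.Sat, Term.val, Structure.one_eq, Structure.add_eq, Structure.zero_eq] using this

theorem succ_inj {a b : M.carrier} : a + 1 = b + 1 → a = b := by
  have h := Structure.models_basic (M := M) .succ_inj
  rw [Structure.models_close] at h
  have := h ![a, b] Fin.elim0
  simpa [Formula.Sat, Term.val, Structure.one_eq, Structure.add_eq] using this

theorem add_zero (a : M.carrier) : a + 0 = a := by
  have h := Structure.models_basic (M := M) .add_zero
  rw [Structure.models_close] at h
  have := h ![a] Fin.elim0
  simpa [Formula.Sat, Term.val, Structure.add_eq, Structure.zero_eq] using this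

theorem add_succ (a b : M.carrier) : a + (b + 1) = a + b + 1 := by
  have h := Structure.models_basic (M := M) .add_succ
  rw [Structure.models_close] at h
  have := h ![a, b] Fin.elim0
  simpa [Formula.Sat, Term.val, Structure.one_eq, Structure.add_eq] using this

theorem mul_zero (a : M.carrier) : a * 0 = 0 := by
  have h := Structure.models_basic (M := M) .mul_zero
  rw [Structure.models_close] at h
  have := h ![a] Fin.elim0
  simpa [Formula.Sat, Term.val, Structure.mul_eq, Structure.zero_eq] using this

theorem mul_succ (a b : M.carrier) : a * (b + 1) = a * b + a := by
  have h := Structure.models_basic (M := M) .mul_succ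
  rw [Structure.models_close] at h
  have := h ![a, b] Fin.elim0
  simpa [Formula.Sat, Term.val, Structure.one_eq, Structure.add_eq, Structure.mul_eq] using this

theorem not_lt_zero (a : M.carrier) : ¬ a < 0 := by
  have h := Structure.models_basic (M := M) .not_lt_zero
  rw [Structure.models_close] at h
  have := h ![a] Fin.elim0
  simpa [Formula.Sat, Term.val, Structure.lt_iff, Structure.zero_eq] using this

theorem lt_succ (a b : M.carrier) : a < b + 1 ↔ a < b ∨ a = b := by
  have h := Structure.models_basic (M := M) .lt_succ
  rw [Structure.models_close] at h
  have := h ![a, b] Fin.elim0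
  simpa [Formula.Sat, Term.val, Structure.one_eq, Structure.add_eq, Structure.lt_iff] using this

theorem equation_induction {p : ℕ} {s t : (Fin p → M.carrier) → M.carrier → M.carrier}
    (hs : TermDef M fun e : Fin (p + 1) → M.carrier => s (Fin.init e) (e (Fin.last p)))
    (ht : TermDef M fun e : Fin (p + 1) → M.carrier => t (Fin.init e) (e (Fin.last p)))
    (e : Fin p → M.carrier) (h0 : s e 0 = t e 0)
    (ih : ∀ a, s e a = t e a → s e (a + 1) = t e (a + 1)) (a : M.carrier) : s e a = t e a :=
  sigma01_induction (R := fun e (_ : Fin 0 → M.sets) a => s e a = t e a)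
    (Sigma00Def.eq hs ht).sigma01Def e Fin.elim0 h0 ih a

theorem add_assoc (a b c : M.carrier) : a + b + c = a + (b + c) := by
  refine equation_induction (s := fun e c => e 0 + e 1 + c) (t := fun e c => e 0 + (e 1 + c))
    (.add (.add (.var _) (.var _)) (.var _)) (.add (.var _) (.add (.var _) (.var _)))
    ![a, b] ?_ (fun x hx => ?_) c
  · simp [add_zero]
  · simp only [add_succ, hx]

theorem zero_add (a : M.carrier) : 0 + a = a := by
  refine equation_induction (s := fun _ c => 0 + c) (t := fun _ c => c)
    (.add .zero (.var _)) (.var _) ![] ?_ (fun x hx => ?_) a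
  · simp [add_zero]
  · simp only [add_succ, hx]

theorem succ_add (a b : M.carrier) : a + 1 + b = a + b + 1 := by
  refine equation_induction (s := fun e c => e 0 + 1 + c) (t := fun e c => e 0 + c + 1)
    (.add (.add (.var _) .one) (.var _)) (.add (.add (.var _) (.var _)) .one) ![a] ?_
    (fun x hx => ?_) b
  · simp [add_zero]
  · simp only [add_succ, hx]

theorem add_comm (a b : M.carrier) : a + b = b + a := by
  refine equation_induction (s := fun e c => e 0 + c) (t := fun e c => c + e 0)
    (.add (.var _) (.var _)) (.add (.var _) (.var _)) ![a] ?_ (fun x hx => ?_) b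
  · simp [add_zero, zero_add]
  · simp only [add_succ, succ_add, hx]

theorem mul_add (a b c : M.carrier) : a * (b + c) = a * b + a * c := by
  refine equation_induction (s := fun e c => e 0 * (e 1 + c)) (t := fun e c => e 0 * e 1 + e 0 * c)
    (.mul (.var _) (.add (.var _) (.var _)))
    (.add (.mul (.var _) (.var _)) (.mul (.var _) (.var _))) ![a, b] ?_ (fun x hx => ?_) c
  · simp [add_zero, mul_zero]
  · rw [add_succ, mul_succ, hx, mul_succ, add_assoc]

theorem mul_assoc (a b c : M.carrier) : a * b * c = a * (b * c) := by
  refine equation_induction (s := fun e c => e 0 * e 1 * c) (t := fun e c => e 0 * (e 1 * c))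
    (.mul (.mul (.var _) (.var _)) (.var _)) (.mul (.var _) (.mul (.var _) (.var _)))
    ![a, b] ?_ (fun x hx => ?_) c
  · simp [mul_zero]
  · rw [mul_succ, mul_succ, mul_add, hx]

theorem zero_mul (a : M.carrier) : 0 * a = 0 := by
  refine equation_induction (s := fun _ c => 0 * c) (t := fun _ _ => 0)
    (.mul .zero (.var _)) .zero ![] ?_ (fun x hx => ?_) a
  · simp [mul_zero]
  · simp only [mul_succ, hx, add_zero]

theorem succ_mul (a b : M.carrier) : (a + 1) * b = a * b + b := by
  refine equation_induction (s := fun e c => (e 0 + 1) * c) (t := fun e c => e 0 * c + c)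
    (.mul (.add (.var _) .one) (.var _)) (.add (.mul (.var _) (.var _)) (.var _))
    ![a] ?_ (fun x hx => ?_) b
  · simp [mul_zero, add_zero]
  · rw [mul_succ, mul_succ, hx, ← add_assoc, ← add_assoc, add_assoc _ x, add_comm x, ← add_assoc]

theorem mul_comm (a b : M.carrier) : a * b = b * a := by
  refine equation_induction (s := fun e c => e 0 * c) (t := fun e c => c * e 0)
    (.mul (.var _) (.var _)) (.mul (.var _) (.var _)) ![a] ?_ (fun x hx => ?_) b
  · simp [mul_zero, zero_mul]
  · simp only [mul_succ, succ_mul, hx]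

theorem mul_one (a : M.carrier) : a * 1 = a := by
  rw [← zero_add 1, mul_succ, mul_zero, zero_add]

instance : CommSemiring M.carrier where
  add_assoc := add_assoc
  zero_add := zero_add
  add_zero := add_zero
  add_comm := add_comm
  left_distrib := mul_add
  right_distrib a b c := by rw [mul_comm, mul_add, mul_comm c, mul_comm c]
  zero_mul := zero_mul
  mul_zero := mul_zero
  mul_assoc := mul_assoc
  one_mul a := by rw [mul_comm, mul_one]
  mul_one := mul_one
  mul_comm := mul_comm
  nsmul := nsmulRec

/-! ### Cancellation and the order -/

theorem add_right_cancel {a b : M.carrier} (c : M.carrier) : a + c = b + c → a = b := by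
  refine sigma01_induction
    (R := fun e (_ : Fin 0 → M.sets) c => (e 0 : M.carrier) + c = e 1 + c → e 0 = e 1)
    (Sigma00Def.imp (.eq (.add (.var _) (.var _)) (.add (.var _) (.var _)))
      (.eq (.var _) (.var _))).sigma01Def ![a, b] Fin.elim0 ?_ (fun x hx h => ?_) c
  · simp
  · rw [← _root_.add_assoc, ← _root_.add_assoc] at h
    exact hx (succ_inj h)

/-- The quantifier stands in front of the disjunction so that the induction formula is literally
Σ⁰₁. -/
theorem eq_zero_or_succ (a : M.carrier) : ∃ k, a = 0 ∨ a = k + 1 :=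
  sigma01_induction (R := fun _ (_ : Fin 0 → M.sets) x => ∃ k : M.carrier, x = 0 ∨ x = k + 1)
    (.ex (Sigma00Def.or (.eq (.var _) .zero) (.eq (.var _) (.add (.var _) .one))).sigma01Def)
    ![] Fin.elim0 ⟨0, Or.inl rfl⟩ (fun x _ => ⟨x, Or.inr rfl⟩) a

theorem exists_of_lt {a b : M.carrier} (h : a < b) : ∃ k, a + k + 1 = b := by
  -- Moving the hypothesis inside the existential quantifier makes the induction formula Σ⁰₁.
  suffices ∃ k, a < b → a + k + 1 = b from this.imp fun _ hk => hk h
  clear h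
  refine sigma01_induction
    (R := fun e (_ : Fin 0 → M.sets) x => ∃ k : M.carrier, e 0 < x → e 0 + k + 1 = x)
    (.ex (Sigma00Def.imp (.lt (.var _) (.var _))
      (.eq (.add (.add (.var _) (.var _)) .one) (.var _))).sigma01Def)
    ![a] Fin.elim0 ⟨0, fun h => (not_lt_zero _ h).elim⟩ (fun x ⟨k, hk⟩ => ?_) b
  by_cases hx : a = x
  · exact ⟨0, fun _ => by simp [hx]⟩
  · refine ⟨k + 1, fun h => ?_⟩
    have := hk (((lt_succ _ _).1 h).resolve_right hx)
    rw [← _root_.add_assoc, this]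

theorem lt_add_succ (a k : M.carrier) : a < a + k + 1 := by
  refine sigma01_induction (R := fun e (_ : Fin 0 → M.sets) x => (e 0 : M.carrier) < e 0 + x + 1)
    (Sigma00Def.lt (.var _) (.add (.add (.var _) (.var _)) .one)).sigma01Def
    ![a] Fin.elim0 ?_ (fun x hx => ?_) k
  · simp [lt_succ]
  · rw [← _root_.add_assoc, lt_succ]
    exact Or.inl hx

theorem exists_add_or (a b : M.carrier) : ∃ k, a + k = b ∨ b + k = a := by
  refine sigma01_induction
    (R := fun e (_ : Fin 0 → M.sets) x => ∃ k : M.carrier, e 0 + k = x ∨ x + k = e 0)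
    (.ex (Sigma00Def.or (.eq (.add (.var _) (.var _)) (.var _))
      (.eq (.add (.var _) (.var _)) (.var _))).sigma01Def)
    ![a] Fin.elim0 ⟨a, Or.inr (_root_.zero_add _)⟩ (fun x ⟨k, hk⟩ => ?_) b
  rcases hk with hk | hk
  · exact ⟨k + 1, Or.inl (by rw [← hk, _root_.add_assoc])⟩
  · obtain ⟨l, rfl | rfl⟩ := eq_zero_or_succ k
    · exact ⟨1, Or.inl (by rw [← hk, _root_.add_zero])⟩
    · exact ⟨l, Or.inr (by rw [← hk]; ring)⟩

theorem eq_zero_of_add_eq_zero {a b : M.carrier} (h : a + b = 0) : b = 0 := by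
  obtain ⟨l, rfl | rfl⟩ := eq_zero_or_succ b
  · rfl
  · rw [← _root_.add_assoc] at h
    exact (succ_ne_zero _ h).elim

theorem add_right_eq_self {a b : M.carrier} (h : a + b = a) : b = 0 :=
  add_right_cancel a (by rw [_root_.zero_add, _root_.add_comm, h])

/-- Here < is the primitive relation of the structure, while ≤ is defined by addition;
`exists_of_lt` and `lt_add_succ` make the two fit together. -/
noncomputable instance : LinearOrder M.carrier where
  le a b := ∃ k, a + k = b
  lt a b := a < b
  le_refl a := ⟨0, add_zero a⟩
  le_trans a b c := by
    rintro ⟨k, rfl⟩ ⟨l, rfl⟩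
    exact ⟨k + l, by ring⟩
  lt_iff_le_not_ge a b := by
    constructor
    · intro h
      obtain ⟨k, rfl⟩ := exists_of_lt h
      refine ⟨⟨k + 1, by ring⟩, ?_⟩
      rintro ⟨l, hl⟩
      have : k + l + 1 = 0 := add_right_eq_self (a := a) (.trans (by ring) hl)
      exact succ_ne_zero _ this
    · rintro ⟨⟨k, rfl⟩, h⟩
      obtain ⟨l, rfl | rfl⟩ := eq_zero_or_succ k
      · exact (h ⟨0, by ring⟩).elim
      · rw [← _root_.add_assoc]
        exact lt_add_succ _ _
  le_antisymm a b := by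
    rintro ⟨k, rfl⟩ ⟨l, hl⟩
    have : k + l = 0 := add_right_eq_self (a := a) (by rw [← _root_.add_assoc, hl])
    rw [_root_.add_comm] at this
    rw [eq_zero_of_add_eq_zero this, _root_.add_zero]
  le_total a b := by
    obtain ⟨k, h | h⟩ := exists_add_or a b
    · exact Or.inl ⟨k, h⟩
    · exact Or.inr ⟨k, h⟩
  toDecidableLE := Classical.decRel _

theorem lt_succ_iff {a b : M.carrier} : a < b + 1 ↔ a ≤ b := by
  rw [lt_succ, le_iff_lt_or_eq]

instance : CanonicallyOrderedAdd M.carrier where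
  exists_add_of_le h := h.imp fun _ h => h.symm
  le_self_add _ b := ⟨b, rfl⟩
  le_add_self _ b := ⟨b, add_comm _ _⟩

instance : Nontrivial M.carrier := ⟨0 + 1, 0, succ_ne_zero 0⟩

instance : IsStrictOrderedRing M.carrier where
  add_le_add_left a b h c := by
    obtain ⟨k, rfl⟩ := h
    exact ⟨k, by ring⟩
  le_of_add_le_add_left a b c h := by
    obtain ⟨k, hk⟩ := h
    exact ⟨k, add_right_cancel a (by rw [add_comm c, ← hk]; ring)⟩
  zero_le_one := zero_le
  mul_lt_mul_of_pos_left a ha b c h := by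
    obtain ⟨k, rfl⟩ := exists_of_lt h
    obtain ⟨l, rfl⟩ := exists_of_lt ha
    exact lt_of_lt_of_eq (lt_add_succ _ (l * k + l + k)) (by ring)
  mul_lt_mul_of_pos_right a ha b c h := by
    obtain ⟨k, rfl⟩ := exists_of_lt h
    obtain ⟨l, rfl⟩ := exists_of_lt ha
    exact lt_of_lt_of_eq (lt_add_succ _ (l * k + l + k)) (by ring)

end Arith

end SOA

namespace SOA

variable {M : Structure.{u}}

/-! ### Coding of finite sets -/

theorem TermDef.init {p : ℕ} {t : (Fin p → M.carrier) → M.carrier} (ht : TermDef M t) :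
    TermDef M fun e : Fin (p + 1) → M.carrier => t (Fin.init e) := by
  obtain ⟨s, hs⟩ := ht
  exact ⟨s.lift 1, fun e => (Term.val_lift _ _ _).trans (hs _)⟩

/-- The number `u` belongs to the finite set coded by `a` and `b`. -/
def Code (a b u : M.carrier) : Prop := ∃ c, c < a + 1 ∧ a = (1 + (u + 1) * b) * c

/-- The values of the function `ℕ → [n]` coded by `a` and `b`: the value at `i` is the least `j ≤ n`
such that the pair `(i, j)` belongs to the coded set, and `0` if there is none. -/
def CodeVal (a b n i j : M.carrier) : Prop :=
  (Code a b (M.pair i j) ∧ ∀ k, k < j → ¬ Code a b (M.pair i k)) ∨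
    (j = 0 ∧ ∀ k, k < n + 1 → ¬ Code a b (M.pair i k))

/-- The function `ℕ → [n]` coded by `a` and `b`, as a set of pairs. -/
def codeGraph (a b n : M.carrier) : Set M.carrier :=
  {u | ∃ i, i < u + 1 ∧ ∃ j, j < u + 1 ∧ u = M.pair i j ∧ j < n + 1 ∧ CodeVal a b n i j}

theorem Structure.pair_eq (i j : M.carrier) : M.pair i j = (i + j) * (i + j) + i := rfl

section

variable {p q : ℕ} {a b n i j u : (Fin p → M.carrier) → M.carrier}

theorem TermDef.pair (hi : TermDef M i) (hj : TermDef M j) :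
    TermDef M fun e => M.pair (i e) (j e) :=
  .add (.mul (.add hi hj) (.add hi hj)) hi

theorem Sigma00Def.code (ha : TermDef M a) (hb : TermDef M b) (hu : TermDef M u) :
    Sigma00Def M fun e (_ : Fin q → M.sets) => Code (a e) (b e) (u e) :=
  .ex_lt (.add ha .one) (.eq ha.init (.mul (.add .one (.mul (.add hu.init .one) hb.init)) (.var _)))

theorem Sigma00Def.codeVal (ha : TermDef M a) (hb : TermDef M b) (hn : TermDef M n)
    (hi : TermDef M i) (hj : TermDef M j) :
    Sigma00Def M fun e (_ : Fin q → M.sets) => CodeVal (a e) (b e) (n e) (i e) (j e) :=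
  .or (.and (.code ha hb (.pair hi hj))
      (.all_lt hj (.not (.code ha.init hb.init (.pair hi.init (.var _))))))
    (.and (.eq hj .zero)
      (.all_lt (.add hn .one) (.not (.code ha.init hb.init (.pair hi.init (.var _))))))

theorem Sigma00Def.mem_codeGraph (ha : TermDef M a) (hb : TermDef M b) (hn : TermDef M n)
    (hu : TermDef M u) :
    Sigma00Def M fun e (_ : Fin q → M.sets) => u e ∈ codeGraph (a e) (b e) (n e) :=
  .ex_lt (.add hu .one) (.ex_lt (.add hu.init .one)
    (.and (.eq hu.init.init (.pair (TermDef.var _).init (.var _)))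
      (.and (.lt (.var _) (.add hn.init.init .one))
        (.codeVal ha.init.init hb.init.init hn.init.init (TermDef.var _).init (.var _)))))

end

variable [ModelsRCA0 M]

open Arith

/-- Comprehension turns the relation into a set; if it had no least element, induction would show
that no element lies below any x. -/
theorem sigma00_least {p q : ℕ}
    {R : (Fin p → M.carrier) → (Fin q → M.sets) → M.carrier → Prop}
    (hR : Sigma00Def M fun (e : Fin (p + 1) → M.carrier) E => R (Fin.init e) E (e (Fin.last p)))
    (e : Fin p → M.carrier) (E : Fin q → M.sets) (h : ∃ a, R e E a) :
    ∃ a, R e E a ∧ ∀ b, b < a → ¬ R e E b := by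
  by_contra! hc
  obtain ⟨a, ha⟩ := h
  refine sigma01_induction (R := fun _ (Y : Fin 1 → M.sets) x => ∀ b, b < x → ¬ b ∈ (Y 0).1)
    (Sigma00Def.all_lt (.var _) (.not (.mem (.var _) _))).sigma01Def ![]
    ![⟨_, sigma00_comprehension hR e E⟩] (fun b hb => (not_lt_zero b hb).elim)
    (fun x hx b hb => ?_) (a + 1) a (lt_add_one a) ha
  rcases (lt_succ b x).1 hb with hb | rfl
  · exact hx b hb
  · intro hb
    obtain ⟨c, hc, hc'⟩ := hc b hb
    exact hx c hc hc'

theorem dvd_of_dvd_add {d x y : M.carrier} (hd : 0 < d) (h : d ∣ x + y) (hx : d ∣ x) : d ∣ y := by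
  obtain ⟨s, rfl⟩ := hx
  obtain ⟨t, ht⟩ := h
  obtain ⟨r, rfl⟩ : ∃ r, s + r = t :=
    le_of_mul_le_mul_left (show d * s ≤ d * t from ⟨y, ht⟩) hd
  exact ⟨r, add_right_cancel (d * s) (by rw [_root_.add_comm, ht]; ring)⟩

/-- The bound on the quotient makes divisibility by a positive number a Σ⁰₀ relation. -/
theorem dvd_iff_exists_lt {d a : M.carrier} (hd : 0 < d) : d ∣ a ↔ ∃ c, c < a + 1 ∧ a = d * c := by
  refine ⟨?_, fun ⟨c, _, hc⟩ => ⟨c, hc⟩⟩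
  rintro ⟨c, rfl⟩
  refine ⟨c, lt_succ_iff.2 ?_, rfl⟩
  obtain ⟨k, rfl⟩ := exists_of_lt hd
  exact ⟨k * c, by ring⟩

theorem code_iff (a b u : M.carrier) : Code a b u ↔ 1 + (u + 1) * b ∣ a :=
  (dvd_iff_exists_lt (by positivity)).symm

/-- A substitute for the factorial, which would need a definition by recursion; mere existence is
accessible to Σ⁰₁ induction. -/
theorem exists_common_multiple (m : M.carrier) : ∃ b : M.carrier, 0 < b ∧ ∀ i, i < m → i + 1 ∣ b := by
  suffices ∃ b : M.carrier, 0 < b ∧ ∀ i, i < m → ∃ c, c < b + 1 ∧ b = (i + 1) * c by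
    obtain ⟨b, hb, h⟩ := this
    exact ⟨b, hb, fun i hi => (dvd_iff_exists_lt (by positivity)).2 (h i hi)⟩
  refine sigma01_induction (R := fun _ (_ : Fin 0 → M.sets) x => ∃ b : M.carrier,
      0 < b ∧ ∀ i : M.carrier, i < x → ∃ c, c < b + 1 ∧ b = (i + 1) * c)
    (.ex (Sigma00Def.and (.lt .zero (.var _)) (.all_lt (.var _) (.ex_lt (.add (.var _) .one)
      (.eq (.var _) (.mul (.add (.var _) .one) (.var _)))))).sigma01Def)
    ![] Fin.elim0 ⟨1, zero_lt_one, fun i hi => (not_lt_zero i hi).elim⟩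
    (fun x ⟨b, hb, h⟩ => ⟨b * (x + 1), by positivity, fun i hi => ?_⟩) m
  rw [← dvd_iff_exists_lt (by positivity)]
  rcases (lt_succ i x).1 hi with hi | rfl
  · exact ((dvd_iff_exists_lt (by positivity)).2 (h i hi)).mul_right _
  · exact dvd_mul_left _ _

/-- Multiplying by 1 + (x + 1) b at each step, whether or not x is in X, gives a suitable a.
Positivity excludes a = 0, which is divisible by everything. -/
theorem exists_code_superset (X : M.sets) (b m : M.carrier) :
    ∃ a : M.carrier, 0 < a ∧ ∀ u, u < m → u ∈ X.1 → Code a b u := by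
  refine sigma01_induction (R := fun e (E : Fin 1 → M.sets) x => ∃ a : M.carrier,
      0 < a ∧ ∀ u : M.carrier, u < x → u ∈ (E 0).1 → Code a (e 0) u)
    (.ex (Sigma00Def.and (.lt .zero (.var _)) (.all_lt (.var _) (.imp (.mem (.var _) _)
      (.code (.var _) (.var _) (.var _))))).sigma01Def)
    ![b] ![X] ⟨1, zero_lt_one, fun i hi => (not_lt_zero i hi).elim⟩
    (fun x ⟨a, ha, h⟩ => ⟨a * (1 + (x + 1) * b), by positivity, fun u hu huX => ?_⟩) m
  rw [code_iff]
  rcases (lt_succ u x).1 hu with hu | rfl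
  · exact ((code_iff _ _ _).1 (h u hu huX)).mul_right _
  · exact dvd_mul_left _ _

/-- The numbers d = 1 + (u + 1) b and 1 + (v + 1) b behave as coprime. For u < v, the identity (v +
1) d = (u + 1) (1 + (v + 1) b) + (v - u) shows that d divides (v - u) c, and the case v < u is
similar. The difference divides b, so d divides b c, and then also c = d c - (u + 1) b c.
Subtraction is avoided by `dvd_of_dvd_add`. -/
theorem dvd_of_dvd_mul_of_ne {b m u v c : M.carrier} (hb : ∀ i, i < m → i + 1 ∣ b) (hu : u < m)
    (hv : v < m) (huv : u ≠ v) (h : 1 + (u + 1) * b ∣ (1 + (v + 1) * b) * c) :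
    1 + (u + 1) * b ∣ c := by
  have hd : 0 < 1 + (u + 1) * b := by positivity
  have key (k : M.carrier) (hk : k < m) (hc : 1 + (u + 1) * b ∣ (k + 1) * c) :
      1 + (u + 1) * b ∣ c := by
    refine dvd_of_dvd_add hd (x := (u + 1) * (b * c)) ⟨c, by ring⟩ (.mul_left ?_ _)
    obtain ⟨b', hb'⟩ := hb k hk
    have := hc.mul_left b'
    rwa [show b' * ((k + 1) * c) = b * c by rw [hb']; ring] at this
  rcases lt_or_gt_of_ne huv with huv | huv
  · obtain ⟨k, rfl⟩ := exists_of_lt huv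
    refine key k (lt_of_le_of_lt ⟨u + 1, by ring⟩ hv) ?_
    exact dvd_of_dvd_add hd (x := (u + 1) * ((1 + (u + k + 1 + 1) * b) * c))
      ⟨(u + k + 1 + 1) * c, by ring⟩ (h.mul_left _)
  · obtain ⟨k, rfl⟩ := exists_of_lt huv
    refine key k (lt_of_le_of_lt ⟨v + 1, by ring⟩ hu) ?_
    refine dvd_of_dvd_add hd (x := (v + 1) * ((1 + (v + k + 1 + 1) * b) * c)) ?_
      (.mul_left (dvd_mul_right _ _) _)
    exact (h.mul_left (v + k + 1 + 1)).trans (dvd_of_eq (by ring))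

/-- The least positive a divisible by all 1 + (u + 1) b with u ∈ X, u < m has no unwanted divisor 1
+ (v + 1) b: dividing it out would leave a smaller number with the same property. -/
theorem exists_code (X : M.sets) (m : M.carrier) :
    ∃ a b : M.carrier, ∀ u, u < m → (Code a b u ↔ u ∈ X.1) := by
  obtain ⟨b, hb, hbm⟩ := exists_common_multiple m
  obtain ⟨a, ⟨ha, haX⟩, hmin⟩ := sigma00_least (R := fun e (E : Fin 1 → M.sets) a =>
      0 < a ∧ ∀ u : M.carrier, u < e 1 → u ∈ (E 0).1 → Code a (e 0) u)
    (Sigma00Def.and (.lt .zero (.var _)) (.all_lt (.var _) (.imp (.mem (.var _) _)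
      (.code (.var _) (.var _) (.var _))))) ![b, m] ![X] (exists_code_superset X b m)
  refine ⟨a, b, fun v hv => ⟨fun h => ?_, haX v hv⟩⟩
  by_contra hvX
  obtain ⟨c, rfl⟩ := (code_iff _ _ _).1 h
  have hc : 0 < c := pos_of_mul_pos_right ha zero_le
  refine hmin c ?_ ⟨hc, fun u hu huX => ?_⟩
  -- The quotient c is strictly smaller because b > 0 makes the factor exceed 1.
  · obtain ⟨k, hk⟩ := exists_of_lt (show 0 < (v + 1) * b by positivity)
    obtain ⟨l, rfl⟩ := exists_of_lt hc
    rw [← hk]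
    exact lt_of_lt_of_eq (lt_add_succ _ (k + l + k * l)) (by ring)
  · rw [code_iff]
    exact dvd_of_dvd_mul_of_ne hbm hu hv (fun h => hvX (h ▸ huX)) ((code_iff _ _ _).1 (haX u hu huX))

/-! ### Pairs and coded functions -/

theorem le_pair_left (i j : M.carrier) : i ≤ M.pair i j := le_add_self

theorem le_mul_self (a : M.carrier) : a ≤ a * a := by
  obtain ⟨k, rfl | rfl⟩ := eq_zero_or_succ a
  · simp
  · exact ⟨k * (k + 1), by ring⟩

theorem le_pair_right (i j : M.carrier) : j ≤ M.pair i j :=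
  (le_add_self.trans (le_mul_self (i + j))).trans le_self_add

/-- With s = i + j, the code s² + i is at most s² + s and hence less than (s + 1)². -/
theorem pair_lt_of_add_lt {i j i' j' : M.carrier} (h : i + j < i' + j') :
    M.pair i j < M.pair i' j' := by
  obtain ⟨k, hk⟩ := exists_of_lt h
  rw [Structure.pair_eq, Structure.pair_eq, ← hk]
  exact lt_of_lt_of_eq (lt_add_succ _ (i + j + j + i' + k * k + 2 * k + 2 * (i + j) * k)) (by ring)

theorem pair_inj {i j i' j' : M.carrier} (h : M.pair i j = M.pair i' j') : i = i' ∧ j = j' := by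
  rcases lt_trichotomy (i + j) (i' + j') with hlt | heq | hlt
  · exact ((pair_lt_of_add_lt hlt).ne h).elim
  · rw [Structure.pair_eq, Structure.pair_eq, heq] at h
    have hi : i = i' := add_left_cancel h
    subst hi
    exact ⟨rfl, add_left_cancel heq⟩
  · exact ((pair_lt_of_add_lt hlt).ne h.symm).elim

theorem pair_mono {i j i' j' : M.carrier} (hi : i ≤ i') (hj : j ≤ j') :
    M.pair i j ≤ M.pair i' j' := by
  rw [Structure.pair_eq, Structure.pair_eq]
  gcongr

theorem pair_mem_codeGraph (a b n i j : M.carrier) :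
    M.pair i j ∈ codeGraph a b n ↔ j < n + 1 ∧ CodeVal a b n i j := by
  constructor
  · rintro ⟨i', -, j', -, h, hj, hv⟩
    obtain ⟨rfl, rfl⟩ := pair_inj h
    exact ⟨hj, hv⟩
  · rintro ⟨hj, hv⟩
    exact ⟨i, lt_succ_iff.2 (le_pair_left i j), j, lt_succ_iff.2 (le_pair_right i j), rfl, hj, hv⟩

/-- The function `ℕ → [n]` coded by `a` and `b`, as an element of the structure. -/
def codeFun (a b n : M.carrier) : M.sets :=
  ⟨codeGraph a b n, sigma00_comprehension
    (R := fun e (_ : Fin 0 → M.sets) u => u ∈ codeGraph (e 0) (e 1) (e 2))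
    (.mem_codeGraph (.var _) (.var _) (.var _) (.var _)) ![a, b, n] Fin.elim0⟩

theorem exists_codeVal (a b n i : M.carrier) : ∃ j, j < n + 1 ∧ CodeVal a b n i j := by
  by_cases h : ∃ j, j < n + 1 ∧ Code a b (M.pair i j)
  · obtain ⟨j, ⟨hj, hc⟩, hmin⟩ := sigma00_least (R := fun e (_ : Fin 0 → M.sets) j =>
        j < e 2 + 1 ∧ Code (e 0) (e 1) (M.pair (e 3) j))
      (.and (.lt (.var _) (.add (.var _) .one)) (.code (.var _) (.var _) (.pair (.var _) (.var _))))
      ![a, b, n, i] Fin.elim0 h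
    exact ⟨j, hj, Or.inl ⟨hc, fun k hk hck => hmin k hk ⟨hk.trans hj, hck⟩⟩⟩
  · push Not at h
    exact ⟨0, by positivity, Or.inr ⟨rfl, h⟩⟩

theorem codeVal_unique {a b n i j k : M.carrier} (hj : j < n + 1) (hk : k < n + 1)
    (h : CodeVal a b n i j) (h' : CodeVal a b n i k) : k = j := by
  rcases h with ⟨h, hm⟩ | ⟨rfl, h⟩ <;> rcases h' with ⟨h', hm'⟩ | ⟨rfl, h'⟩
  · exact le_antisymm (not_lt.1 fun hlt => hm' _ hlt h) (not_lt.1 fun hlt => hm _ hlt h')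
  · exact (h' j hj h).elim
  · exact (h k hk h').elim
  · rfl

/-- Thanks to the choice of the least value and the default value 0, arbitrary a and b code a
function, so quantifying over codes needs no side condition. -/
theorem isFun_codeFun (a b n : M.carrier) : M.IsFun n (codeFun a b n) := by
  refine ⟨fun m ⟨i, _, j, _, hm, hj, _⟩ => ⟨i, j, hj, hm⟩, fun i => ?_⟩
  obtain ⟨j, hj, hv⟩ := exists_codeVal a b n i
  refine ⟨j, (pair_mem_codeGraph _ _ _ _ _).2 ⟨hj, hv⟩, fun k hk => ?_⟩
  obtain ⟨hk, hv'⟩ := (pair_mem_codeGraph _ _ _ _ _).1 hk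
  exact codeVal_unique hj hk hv hv'

theorem exists_codeFun {n : M.carrier} {g : M.sets} (hg : M.IsFun n g) (m : M.carrier) :
    ∃ a b, M.Agree n m g (codeFun a b n) := by
  -- By monotonicity of pairing, this bound covers all pairs (i, k) with i < m and k ≤ n.
  obtain ⟨a, b, hab⟩ := exists_code g (M.pair m n + 1)
  refine ⟨a, b, fun i hi j hj => ?_⟩
  have hlt (k : M.carrier) (hk : k < n + 1) : Code a b (M.pair i k) ↔ M.pair i k ∈ g.1 :=
    hab _ (lt_succ_iff.2 (pair_mono (le_of_lt hi) (lt_succ_iff.1 hk)))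
  obtain ⟨j₀, hj₀, huniq⟩ := hg.2 i
  have hj₀n : j₀ < n + 1 := by
    obtain ⟨i', j', hj', h⟩ := hg.1 _ hj₀
    rw [(pair_inj h).2]
    exact hj'
  refine Iff.trans ?_ (pair_mem_codeGraph _ _ _ _ _).symm
  have hv : CodeVal a b n i j₀ := by
    refine Or.inl ⟨(hlt _ hj₀n).2 hj₀, fun k hk hc => ?_⟩
    exact hk.ne (huniq k ((hlt k (hk.trans hj₀n)).1 hc))
  refine ⟨fun h => ?_, fun ⟨_, h⟩ => ?_⟩
  · rw [huniq j h]
    exact ⟨hj₀n, hv⟩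
  · rw [codeVal_unique hj₀n hj hv h]
    exact hj₀

end SOA

namespace SOA

variable {M : Structure.{u}}

/-! ### `Σ⁰₀` formulas use finite parts of sets only -/

theorem TermDef.val {p p' : ℕ} (t : Term p) (τ : Fin p → Fin p') :
    TermDef M fun e => t.val M fun i => e (τ i) :=
  ⟨t.subst fun i => .var (τ i), fun e => by simp only [Term.val_subst, Term.val]⟩

theorem snoc_init_comp {p p' : ℕ} (τ : Fin p → Fin p') (e : Fin (p' + 1) → M.carrier) :
    Fin.snoc (α := fun _ : Fin (p + 1) => M.carrier) (fun i => Fin.init e (τ i))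
      (e (Fin.last p')) = fun i => e (Fin.snoc (α := fun _ : Fin (p + 1) => Fin (p' + 1))
        (fun i => (τ i).castSucc) (Fin.last p') i) :=
  (snoc_comp e _ _).symm

theorem snoc_comp_var {p p' : ℕ} (τ : Fin p → Fin p') (e : Fin p' → M.carrier) (a : M.carrier) :
    Fin.snoc (α := fun _ : Fin (p + 1) => M.carrier) (fun i => e (τ i)) a =
      fun i => Fin.snoc (α := fun _ : Fin (p' + 1) => M.carrier) e a
        (Fin.snoc (α := fun _ : Fin (p + 1) => Fin (p' + 1))
          (fun i => (τ i).castSucc) (Fin.last p') i) := by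
  rw [snoc_comp]
  simp

theorem Structure.Agree.symm {n y : M.carrier} {f g : M.sets} (h : M.Agree n y f g) :
    M.Agree n y g f :=
  fun i hi j hj => (h i hi j hj).symm

theorem Structure.Agree.trans {n y : M.carrier} {f g h : M.sets} (hfg : M.Agree n y f g)
    (hgh : M.Agree n y g h) : M.Agree n y f h :=
  fun i hi j hj => (hfg i hi j hj).trans (hgh i hi j hj)

section

variable [ModelsRCA0 M]

open Arith

/-- Terms are built from + and · only and are therefore monotone; this bounds all numbers that a Σ⁰₀
formula can mention. -/
theorem Term.val_le (t : Term p) {e : Fin p → M.carrier} {z : M.carrier} (he : ∀ i, e i ≤ z) :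
    t.val M e ≤ t.val M fun _ => z := by
  induction t with
  | var i => simpa only [Term.val] using he i
  | zero => simp only [Term.val, le_refl]
  | one => simp only [Term.val, le_refl]
  | add s t hs ht =>
    simp only [Term.val]
    exact add_le_add hs ht
  | mul s t hs ht =>
    simp only [Term.val]
    exact mul_le_mul' hs ht

/-- With the free number variables bounded by z, all terms in the formula have bounded values, so
only membership of numbers below some T is ever tested. It is essential that T is chosen before the
sets. -/
theorem IsSigma00.exists_use {p q : ℕ} {φ : Formula p q} (hφ : IsSigma00 φ) (z : M.carrier) :
    ∃ T : M.carrier, ∀ e, (∀ i, e i ≤ z) → ∀ E E' : Fin q → M.sets,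
      (∀ X u, u < T → (u ∈ (E X).1 ↔ u ∈ (E' X).1)) → (φ.Sat M e E ↔ φ.Sat M e E') := by
  induction hφ generalizing z with
  | eq s t => exact ⟨0, fun e _ E E' _ => by simp only [Formula.Sat]⟩
  | lt s t => exact ⟨0, fun e _ E E' _ => by simp only [Formula.Sat]⟩
  | mem t X =>
    refine ⟨(t.val M fun _ => z) + 1, fun e he E E' h => ?_⟩
    simpa only [Formula.Sat] using h X _ (lt_succ_iff.2 (t.val_le he))
  | neg _ ih =>
    obtain ⟨T, hT⟩ := ih z
    exact ⟨T, fun e he E E' h => by simp only [Formula.Sat, hT e he E E' h]⟩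
  | and _ _ ih ih' | or _ _ ih ih' | imp _ _ ih ih' | iff _ _ ih ih' =>
    obtain ⟨T, hT⟩ := ih z
    obtain ⟨T', hT'⟩ := ih' z
    refine ⟨max T T', fun e he E E' h => ?_⟩
    simp only [Formula.Sat, hT e he E E' fun X u hu => h X u (lt_max_of_lt_left hu),
      hT' e he E E' fun X u hu => h X u (lt_max_of_lt_right hu)]
  | allLt t _ ih | exLt t _ ih =>
    -- The quantified variable stays below the value of t, which is at most the value of t with all
    -- variables set to z.
    obtain ⟨T, hT⟩ := ih (max z (t.val M fun _ => z))
    refine ⟨T, fun e he E E' h => ?_⟩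
    have (a : M.carrier) (ha : a < t.val M e) := hT
      (Fin.snoc (α := fun _ => M.carrier) e a) (Fin.lastCases
        (by simpa using Or.inr ((le_of_lt ha).trans (t.val_le he)))
        (fun i => by simpa using Or.inl (he i))) E E' h
    simp only [Formula.sat_allLt, Formula.sat_exLt, Structure.lt_iff]
    first
    | exact forall₂_congr this
    | exact exists_congr fun a => and_congr_right (this a)

/-- The code of a pair is at least its first component, so agreement at arguments below T gives
agreement of the sets of pairs below T. -/
theorem Structure.Agree.mem_iff {n T u : M.carrier} {f g : M.sets} (h : M.Agree n T f g)
    (hf : M.IsFun n f) (hg : M.IsFun n g) (hu : u < T) : u ∈ f.1 ↔ u ∈ g.1 := by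
  constructor
  · intro hm
    obtain ⟨i, j, hj, rfl⟩ := hf.1 u hm
    exact (h i (lt_of_le_of_lt (le_pair_left i j) hu) j hj).1 hm
  · intro hm
    obtain ⟨i, j, hj, rfl⟩ := hg.1 u hm
    exact (h i (lt_of_le_of_lt (le_pair_left i j) hu) j hj).2 hm

theorem Structure.Agree.mono {n y y' : M.carrier} {f g : M.sets} (h : M.Agree n y f g)
    (hy : y' ≤ y) : M.Agree n y' f g :=
  fun i hi => h i (lt_of_lt_of_le hi hy)

/-! ### Formulas stating stability under change of a function beyond an initial segment -/

/-- Membership in a coded function is Σ⁰₀ in the code, so replacing the set variable by such a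
function preserves Σ⁰₀. The renaming τ makes room for the code and varies in the induction because
quantifiers extend it. -/
theorem Sigma00Def.sat_update {p q : ℕ} {φ : Formula p q} (hφ : IsSigma00 φ) {p' : ℕ}
    (τ : Fin p → Fin p') (a b n : Fin p') (l : Fin q) :
    Sigma00Def M fun e E => φ.Sat M (fun i => e (τ i))
      (Function.update E l (codeFun (e a) (e b) (e n))) := by
  induction hφ generalizing p' with
  | eq s t => simpa only [Formula.Sat] using .eq (.val s τ) (.val t τ)
  | lt s t => simpa only [Formula.Sat] using .lt (.val s τ) (.val t τ)
  | mem t X =>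
    simp only [Formula.Sat]
    by_cases hX : X = l
    · subst hX
      simpa only [Function.update_self] using
        .mem_codeGraph (.var a) (.var b) (.var n) (.val t τ)
    · simpa only [Function.update_of_ne hX] using .mem (.val t τ) X
  | neg _ ih => simpa only [Formula.Sat] using (ih τ a b n l).not
  | and _ _ ih ih' => simpa only [Formula.Sat] using (ih τ a b n l).and (ih' τ a b n l)
  | or _ _ ih ih' => simpa only [Formula.Sat] using (ih τ a b n l).or (ih' τ a b n l)
  | imp _ _ ih ih' => simpa only [Formula.Sat] using (ih τ a b n l).imp (ih' τ a b n l)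
  | iff _ _ ih ih' => simpa only [Formula.Sat] using (ih τ a b n l).iff (ih' τ a b n l)
  | allLt t _ ih =>
    simp only [Formula.sat_allLt]
    refine .all_lt (.val t τ) ?_
    simp only [snoc_init_comp]
    exact ih _ a.castSucc b.castSucc n.castSucc l
  | exLt t _ ih =>
    simp only [Formula.sat_exLt]
    refine .ex_lt (.val t τ) ?_
    simp only [snoc_init_comp]
    exact ih _ a.castSucc b.castSucc n.castSucc l

theorem Sigma00Def.agree_codeFun {p q : ℕ} (a b n y : Fin p) (l : Fin q) :
    Sigma00Def M fun e E => M.Agree (e n) (e y) (E l) (codeFun (e a) (e b) (e n)) :=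
  .all_lt (.var _) (.all_lt (.add (.var n.castSucc) .one) (.iff
    (.mem (.pair (TermDef.var _).init (.var _)) _)
    (.mem_codeGraph (.var a.castSucc.castSucc) (.var b.castSucc.castSucc) (.var n.castSucc.castSucc)
      (.pair (TermDef.var _).init (.var _)))))

theorem IsSigma00.forall_fun_iff {p q : ℕ} {φ : Formula p q} (hφ : IsSigma00 φ)
    (e : Fin p → M.carrier) (E : Fin q → M.sets) (n y : M.carrier) (l : Fin q) :
    (∀ g, M.IsFun n g → M.Agree n y (E l) g → φ.Sat M e (Function.update E l g)) ↔
      ∀ a b, M.Agree n y (E l) (codeFun a b n) →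
        φ.Sat M e (Function.update E l (codeFun a b n)) := by
  refine ⟨fun h a b => h _ (isFun_codeFun a b n), fun h g hg hag => ?_⟩
  -- The coded function must match g below y, to satisfy the hypothesis on codes, and below T, to
  -- give the formula the same truth value.
  obtain ⟨z, hz⟩ := Finite.bddAbove_range e
  obtain ⟨T, hT⟩ := hφ.exists_use z
  obtain ⟨a, b, hab⟩ := exists_codeFun hg (max T y)
  refine (hT e (fun i => hz ⟨i, rfl⟩) _ _ fun X u hu => ?_).2
    (h a b (hag.trans (hab.mono (le_max_right _ _))))
  by_cases hX : X = l
  · subst hX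
    simpa only [Function.update_self] using
      (hab.mono (le_max_left _ _)).mem_iff hg (isFun_codeFun a b n) hu
  · simp only [Function.update_of_ne hX]

/-- `B` expresses that `A` is true of all functions `g : ℕ → [n]` that have the same initial segment
of length `y` as the function `l`; the variables of `A` are renamed by `τ`. -/
def ExpressesStability (M : Structure.{u}) {p p' q : ℕ} (A : Formula p q) (τ : Fin p → Fin p')
    (n y : Fin p') (l : Fin q) (B : Formula p' q) : Prop :=
  ∀ e E, B.Sat M e E ↔ ∀ g, M.IsFun (e n) g → M.Agree (e n) (e y) (E l) g →
    A.Sat M (fun i => e (τ i)) (Function.update E l g)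

/-- For a Σ⁰₀ matrix, two universal number quantifiers over codes replace the quantifier over g; the
leading number quantifiers commute with ∀ g. -/
theorem IsPi01.exists_expressesStability {p q : ℕ} {A : Formula p q} (hA : IsPi01 A) {p' : ℕ}
    (τ : Fin p → Fin p') (n y : Fin p') (l : Fin q) :
    ∃ B, IsPi01 B ∧ ExpressesStability M A τ n y l B := by
  induction hA generalizing p' with
  | @sigma00 p q φ hφ =>
    obtain ⟨ψ, hψ, h⟩ := (Sigma00Def.agree_codeFun (M := M) (Fin.last p').castSucc
      (Fin.last (p' + 1)) n.castSucc.castSucc y.castSucc.castSucc l).imp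
      (Sigma00Def.sat_update hφ (fun i => (τ i).castSucc.castSucc) (Fin.last p').castSucc
      (Fin.last (p' + 1)) n.castSucc.castSucc l)
    refine ⟨.allN (.allN ψ), .allN (.allN (.sigma00 hψ)), fun e E => ?_⟩
    rw [hφ.forall_fun_iff]
    simp [Formula.Sat, h]
  | allN _ ih =>
    obtain ⟨B, hB, h⟩ := ih (Fin.snoc (α := fun _ => Fin (p' + 1)) (fun i => (τ i).castSucc)
      (Fin.last p')) n.castSucc y.castSucc l
    refine ⟨.allN B, .allN hB, fun e E => ?_⟩
    simp only [Formula.Sat, h _ _, Fin.snoc_castSucc, snoc_comp_var]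
    exact ⟨fun h g hg hag a => h a g hg hag, fun h a g hg hag => h g hg hag a⟩

end

theorem Formula.exists_expressesStability {p q : ℕ} (A : Formula p q) {p' : ℕ}
    (τ : Fin p → Fin p') (n y : Fin p') (l : Fin q) : ∃ B, ExpressesStability M A τ n y l B := by
  refine ⟨.allFun (.var n) (.imp (.agree (.var n) (.var y) l.castSucc (Fin.last q))
    (A.subst (fun i => .var (τ i)) (Function.update Fin.castSucc l (Fin.last q)))), fun e E => ?_⟩
  simp only [Formula.sat_allFun, Formula.Sat, Formula.sat_agree, Formula.sat_subst, Term.val,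
    Fin.snoc_castSucc, Fin.snoc_last]
  refine forall_congr' fun g => imp_congr_right fun _ => imp_congr_right fun _ => ?_
  refine iff_of_eq (congrArg (A.Sat M _) ?_)
  funext X
  by_cases hX : X = l
  · subst hX
    simp
  · simp [Function.update_of_ne hX]

/-! ### The schemata -/

theorem models_cub_of_cubPrime {p k q : ℕ} {A : Formula (p + k) (q + 1)}
    (h : M.Models (cubPrimeInstance A)) : M.Models (cubInstance A) := by
  rw [models_cubPrimeInstance] at h
  rw [models_cubInstance]
  intro e E n hc ht
  obtain ⟨z, hz⟩ := h e E n hc ht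
  refine ⟨z, fun f hf => ?_⟩
  obtain ⟨x, hx, hA, -⟩ := hz f hf
  exact ⟨x, hx, hA⟩

variable [ModelsRCA0 M]

open Arith

theorem Structure.AllLe.le {k : ℕ} {x : Fin k → M.carrier} {z : M.carrier} (h : M.AllLe x z)
    (i : Fin k) : x i ≤ z :=
  lt_succ_iff.1 (h i)

theorem Structure.AllLe.of_le {k : ℕ} {x : Fin k → M.carrier} {z : M.carrier}
    (h : ∀ i, x i ≤ z) : M.AllLe x z :=
  fun i => lt_succ_iff.2 (h i)

/-- The core of the argument: S is the stability relation of R, with the length y of the initial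
segment as last component of the tuple. -/
theorem Structure.StronglyBounded.of_stability {n : M.carrier} {k : ℕ}
    {R : (Fin k → M.carrier) → M.sets → Prop} {S : (Fin (k + 1) → M.carrier) → M.sets → Prop}
    (hS : ∀ x f, S x f ↔
      ∀ g, M.IsFun n g → M.Agree n (x (Fin.last k)) f g → R (Fin.init x) g)
    (hcub : M.Cont n S → M.Total n S → M.Bounded n S) (hc : M.Cont n R) (ht : M.Total n R) :
    M.StronglyBounded n R := by
  have hcS : M.Cont n S := by
    -- The bound z is its own modulus: as y ≤ z, functions agreeing below z agree with the same
    -- functions below y.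
    refine fun f _ z => ⟨z, fun g _ hfg x hx => ?_⟩
    have hfg := hfg.mono (hx.le (Fin.last k))
    rw [hS, hS]
    exact ⟨fun h g' hg' h' => h g' hg' (hfg.trans h'),
      fun h g' hg' h' => h g' hg' (hfg.symm.trans h')⟩
  have htS : M.Total n S := by
    intro f hf
    obtain ⟨x, hx⟩ := ht f hf
    obtain ⟨z, hz⟩ := Finite.bddAbove_range x
    obtain ⟨y, hy⟩ := hc f hf z
    -- The modulus of continuity of R at f is the required length.
    refine ⟨Fin.snoc (α := fun _ => M.carrier) x y, (hS _ _).2 fun g hg hfg => ?_⟩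
    rw [Fin.snoc_last] at hfg
    rw [Fin.init_snoc]
    exact (hy g hg hfg x (.of_le fun i => hz ⟨i, rfl⟩)).1 hx
  obtain ⟨z, hz⟩ := hcub hcS htS
  refine ⟨z, fun f hf => ?_⟩
  obtain ⟨x, hx, hSx⟩ := hz f hf
  rw [hS] at hSx
  -- Stability applied to g = f gives R itself; for the other g, agreement below z restricts to
  -- agreement below y ≤ z.
  exact ⟨Fin.init x, fun i => hx _, hSx f hf fun _ _ _ _ => Iff.rfl,
    fun g hg hfg => hSx g hg (hfg.mono (hx.le _))⟩

theorem models_cubPrime_of_stability {Γ : ∀ {p q : ℕ}, Formula p q → Prop}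
    (hΓ : ∀ {p p' q : ℕ} (A : Formula p q), Γ A → ∀ (τ : Fin p → Fin p') (n y : Fin p')
      (l : Fin q), ∃ B, Γ B ∧ ExpressesStability M A τ n y l B)
    (hM : ∀ φ ∈ CUB Γ, M.Models φ) {p k q : ℕ} {A : Formula (p + k) (q + 1)} (hA : Γ A) :
    M.Models (cubPrimeInstance A) := by
  rw [models_cubPrimeInstance]
  intro e E n
  -- The variables of B are the parameters of A, then n, then x, then y. The renaming skips n and y.
  obtain ⟨B, hB, h⟩ := hΓ A hA (p' := p + 1 + (k + 1))
    (Fin.addCases (fun i => Fin.castAdd (k + 1) i.castSucc)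
      fun j => Fin.natAdd (p + 1) j.castSucc)
    (Fin.castAdd (k + 1) (Fin.last p)) (Fin.natAdd (p + 1) (Fin.last k)) (Fin.last q)
  -- The number n is used twice: as a parameter of B and as the n of the CUB instance.
  have hcub := (models_cubInstance B).1 (hM _ ⟨_, _, _, B, hB, rfl⟩)
    (Fin.snoc (α := fun _ => M.carrier) e n) E n
  refine Structure.StronglyBounded.of_stability (fun x f => ?_) hcub
  rw [Formula.rel, h]
  simp only [Fin.append_left, Fin.append_right, Fin.snoc_last, Fin.update_snoc_last, Formula.rel]
  refine forall_congr' fun g => imp_congr_right fun _ => imp_congr_right fun _ => ?_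
  refine iff_of_eq (congrArg (fun e => A.Sat M e _) ?_)
  funext i
  refine Fin.addCases (fun i => ?_) (fun i => ?_) i <;> simp [Fin.init]

theorem models_cubPrime_of_cub_of_sigma00 {p k q : ℕ} {A : Formula (p + k) (q + 1)}
    (hA : IsSigma00 A) (h : M.Models (cubInstance A)) : M.Models (cubPrimeInstance A) := by
  rw [models_cubInstance] at h
  rw [models_cubPrimeInstance]
  intro e E n hc ht
  obtain ⟨z, hz⟩ := h e E n hc ht
  obtain ⟨z', hz'⟩ := Finite.bddAbove_range e
  -- The bound covers both x and the number parameters, so T is uniform in f and x.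
  obtain ⟨T, hT⟩ := hA.exists_use (max z z')
  refine ⟨max z T, fun f hf => ?_⟩
  obtain ⟨x, hx, hxf⟩ := hz f hf
  refine ⟨x, .of_le fun i => (hx.le i).trans (le_max_left _ _), hxf, fun g hg hfg => ?_⟩
  refine (hT _ (Fin.addCases (fun i => ?_) fun i => ?_) _ _
    (Fin.lastCases (fun u hu => ?_) fun X u _ => ?_)).1 hxf
  · simpa using Or.inr (hz' ⟨i, rfl⟩)
  · simpa using Or.inl (hx.le i)
  · simpa using (hfg.mono (le_max_right _ _)).mem_iff hf hg hu
  · simp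

end SOA

theorem proposition2 :
    SOA.EquivOver.{u} SOA.RCA0 (SOA.CUB SOA.IsSigma00) (SOA.CUBPrime SOA.IsSigma00) ∧
    SOA.EquivOver.{u} SOA.RCA0 (SOA.CUB SOA.IsPi01) (SOA.CUBPrime SOA.IsPi01) ∧
    SOA.EquivOver.{u} SOA.RCA0 (SOA.CUB SOA.AnyFormula) (SOA.CUBPrime SOA.AnyFormula) := by
  have cub {Γ : ∀ {p q : ℕ}, SOA.Formula p q → Prop} :
      ∀ φ ∈ SOA.CUB Γ, SOA.Entails.{u} (SOA.RCA0 ∪ SOA.CUBPrime Γ) φ := by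
    rintro φ ⟨p, k, q, A, hA, rfl⟩ M hM
    exact SOA.models_cub_of_cubPrime (hM _ (Or.inr ⟨p, k, q, A, hA, rfl⟩))
  refine ⟨⟨?_, cub⟩, ⟨?_, cub⟩, ⟨?_, cub⟩⟩
  · rintro φ ⟨p, k, q, A, hA, rfl⟩ M hM
    have : SOA.ModelsRCA0 M := ⟨fun ψ hψ => hM ψ (Or.inl hψ)⟩
    exact SOA.models_cubPrime_of_cub_of_sigma00 hA (hM _ (Or.inr ⟨p, k, q, A, hA, rfl⟩))
  · rintro φ ⟨p, k, q, A, hA, rfl⟩ M hM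
    have : SOA.ModelsRCA0 M := ⟨fun ψ hψ => hM ψ (Or.inl hψ)⟩
    exact SOA.models_cubPrime_of_stability (Γ := SOA.IsPi01)
      (fun A hA => hA.exists_expressesStability) (fun ψ hψ => hM ψ (Or.inr hψ)) hA
  · rintro φ ⟨p, k, q, A, hA, rfl⟩ M hM
    have : SOA.ModelsRCA0 M := ⟨fun ψ hψ => hM ψ (Or.inl hψ)⟩
    exact SOA.models_cubPrime_of_stability (Γ := SOA.AnyFormula)
      (fun A _ τ n y l => (A.exists_expressesStability τ n y l).imp fun _ h => ⟨trivial, h⟩)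
      (fun ψ hψ => hM ψ (Or.inr hψ)) hA
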